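/- Let $s\ge 1$ and $n\ge 0$ be integers and let $M$ be a nonempty $(2n+s)$-dimensional $S$-manifold. That is, $M$ is a smooth manifold with a Riemannian metric $g$, a $(1,1)$-tensor field $f$, vector fields $\xi_1,\dots,\xi_s$ and 1-forms $\eta^1,\dots,\eta^s$ such that $f^2=-I+\sum_\alpha\eta^\alpha\otimes\xi_\alpha$, $\eta^\alpha(\xi_\beta)=\delta_{\alpha\beta}$, $f\xi_\alpha=0$, $\eta^\alpha\circ f=0$, $g(fX,fY)=g(X,Y)-\sum_\alpha\eta^\alpha(X)\eta^\alpha(Y)$, $[f,f]+2\sum_\alpha d\eta^\alpha\otimes\xi_\alpha=0$ (where $[f,f]$ is the Nijenhuis torsion), and $d\eta^\alpha(X,Y)=g(X,fY)$ for every $\alpha$, with the convention $2\,d\eta(X,Y)=X\eta(Y)-Y\eta(X)-\eta([X,Y])$. Let $\mathcal L$ be the orthogonal complement of the span of $\xi_1,\dots,\xi_s$, let $\nabla$ be the Levi-Civita connection of $g$, and let $\nabla^*$ be the semi-symmetric metric connection $$\nabla^*_XY=\nabla_XY+\sum_{j=1}^s\eta^j(Y)X-\sum_{j=1}^s g(X,Y)\,\xi_j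 .$$ For a connection $D$ with curvature $R(X,Y)Z=D_XD_YZ-D_YD_XZ-D_{[X,Y]}Z$, put $K(X,Y)=g(R(X,Y)Y,X)$ for orthonormal $X,Y$ and $K(X,X)=0$. The $\mathcal L$-sectional curvature is the restriction of $K$ to orthonormal pairs in $\mathcal L$. The $f$-sectional curvature is $K(X,fX)$ for unit $X\in\mathcal L$. The scalar curvature is $\tau=\frac12\sum_{i,j=1}^{2n+s}K(e_i,e_j)$ for an orthonormal frame $\{e_i\}$. Write $K^*$, $K^*_{\mathcal L}$, $\tau^*$ for these quantities for $\nabla^*$. (1) Suppose that $n\ge 2$. If $K^*_{\mathcal L}$ is constant, equal to $c$, then $c=0$, and at every point and in every orthonormal frame $$\tau^*=\frac{(4ns+s(s-1))(2-s)}{2}.$$ (2) If the $f$-sectional curvature of $\nabla$ is constant, equal to $c$ (that is, $M$ is an $S$-space-form $M(c)$), then $$K^*_{\mathcal L}(X,Y)=\frac{c-s}{4}\bigl(1+3g(X,fY)^2\bigr)$$ for all orthonormal $X,Y\in\mathcal L$, and at every point and in every orthonormal frame $$\tau^*=\frac{n(n+1)(c-s)+(4ns+s(s-1))(2-s)}{2}.$$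 -/

import Mathlib

open Bundle VectorField
open scoped Manifold ContDiff InnerProductSpace

noncomputable section

/-! ### Connections on a Riemannian manifold and their curvature -/

section Curvature

variable {E : Type*} [NormedAddCommGroup E] [NormedSpace ℝ E]
  {H : Type*} [TopologicalSpace H] {I : ModelWithCorners ℝ E H}
  {M : Type*} [TopologicalSpace M] [ChartedSpace H M]

/-- `X` is a smooth vector field on `M`, that is, `X ∈ 𝔛(M)`. -/
def IsSmoothVectorField [IsManifold I 1 M] (X : Π x : M, TangentSpace I x) : Prop :=
  ContMDiff I I.tangent ∞ (fun x ↦ (⟨x, X x⟩ : TangentBundle I M))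

/-- The Riemannian (Levi-Civita) connection of the metric of `M`: the smooth linear connection that
is symmetric (torsion-free) and metric. These properties determine it uniquely. -/
structure IsLeviCivita [FiniteDimensional ℝ E]
    [IsManifold I ∞ M]
    [RiemannianBundle (fun x : M ↦ TangentSpace I x)]
    [IsContMDiffRiemannianBundle I ∞ E (fun x : M ↦ TangentSpace I x)]
    (nabla : CovariantDerivative I E (fun x : M ↦ TangentSpace I x)) : Prop where
  smooth : CovariantDerivative.ContMDiffCovariantDerivative nabla ∞
  symmetric : nabla.torsion = 0
  metric : CovariantDerivative.IsMetricCompatible (V := fun x : M ↦ TangentSpace I x) nabla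

variable [IsManifold I 1 M]

/-- The curvature operator of a linear connection on vector fields,
`R(X, Y) Z = ∇_X ∇_Y Z - ∇_Y ∇_X Z - ∇_[X, Y] Z`.
In Mathlib `∇_X Z` at `x` is written `nabla Z x (X x)`. -/
def curvatureField (nabla : CovariantDerivative I E (fun x : M ↦ TangentSpace I x))
    (X Y Z : Π x : M, TangentSpace I x) (x : M) : TangentSpace I x :=
  nabla (fun y ↦ nabla Z y (Y y)) x (X x) - nabla (fun y ↦ nabla Z y (X y)) x (Y x)
    - nabla Z x (mlieBracket I X Y x)

/-- The curvature tensor `R(u, v) w` on tangent vectors at `x`, computed with extensions of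
`u`, `v`, `w` to vector fields that are smooth near `x` (for a smooth connection the result does
not depend on the extensions). -/
def curvatureAt (nabla : CovariantDerivative I E (fun x : M ↦ TangentSpace I x)) (x : M)
    (u v w : TangentSpace I x) : TangentSpace I x :=
  curvatureField nabla (FiberBundle.extend E u) (FiberBundle.extend E v) (FiberBundle.extend E w) x

variable [RiemannianBundle (fun x : M ↦ TangentSpace I x)]

/-- The sectional curvature `K(u, v) = g(R(u, v) v, u) / (g(u, u) g(v, v) - g(u, v)²)`;
it is `g(R(u, v) v, u)` for orthonormal `u`, `v`, and `0` when `u = v`. -/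
def sectionalCurvature (nabla : CovariantDerivative I E (fun x : M ↦ TangentSpace I x)) (x : M)
    (u v : TangentSpace I x) : ℝ :=
  ⟪curvatureAt nabla x u v v, u⟫_ℝ / (⟪u, u⟫_ℝ * ⟪v, v⟫_ℝ - ⟪u, v⟫_ℝ ^ 2)

/-- The scalar curvature `τ = (1/2) ∑_{i,j} K(e_i, e_j)` at `x`, computed in the orthonormal basis
`e` of the tangent space at `x`. -/
def scalarCurvature {ι : Type*} [Fintype ι]
    (nabla : CovariantDerivative I E (fun x : M ↦ TangentSpace I x)) (x : M)
    (e : OrthonormalBasis ι ℝ (TangentSpace I x)) : ℝ :=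
  (1 / 2) * ∑ i, ∑ j, sectionalCurvature nabla x (e i) (e j)

end Curvature

/-! ### Metric `f`-structures and `S`-structures -/

/-- A metric `f`-structure with `s` structure vector fields on the Riemannian manifold `M`:
a `(1,1)`-tensor field `f`, vector fields `ξ_1, …, ξ_s` and 1-forms `η^1, …, η^s`, all smooth, with
`f² = -I + ∑ η^α ⊗ ξ_α`, `η^α(ξ_β) = δ_αβ`, `f ξ_α = 0`, `η^α ∘ f = 0` and
`g(fX, fY) = g(X, Y) - ∑ η^α(X) η^α(Y)`. -/
structure MetricFStructure {E : Type*} [NormedAddCommGroup E] [NormedSpace ℝ E]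
    {H : Type*} [TopologicalSpace H] (I : ModelWithCorners ℝ E H)
    (M : Type*) [TopologicalSpace M] [ChartedSpace H M] [IsManifold I 1 M]
    [RiemannianBundle (fun x : M ↦ TangentSpace I x)] (s : ℕ) where
  /-- the `(1,1)`-tensor field -/
  f : Π x : M, TangentSpace I x →L[ℝ] TangentSpace I x
  /-- the structure vector fields -/
  xi : Fin s → Π x : M, TangentSpace I x
  /-- the dual 1-forms -/
  eta : Fin s → Π x : M, TangentSpace I x →L[ℝ] ℝ
  smooth_f : ContMDiff I (I.prod 𝓘(ℝ, E →L[ℝ] E)) ∞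
    (fun x ↦ (⟨x, f x⟩ :
      TotalSpace (E →L[ℝ] E) (fun x : M ↦ TangentSpace I x →L[ℝ] TangentSpace I x)))
  smooth_xi : ∀ α, IsSmoothVectorField (xi α)
  smooth_eta : ∀ α, ContMDiff I (I.prod 𝓘(ℝ, E →L[ℝ] ℝ)) ∞
    (fun x ↦ (⟨x, eta α x⟩ :
      TotalSpace (E →L[ℝ] ℝ) (fun x : M ↦ TangentSpace I x →L[ℝ] Bundle.Trivial M ℝ x)))
  f_f : ∀ x v, f x (f x v) = -v + ∑ α, eta α x v • xi α x
  eta_xi : ∀ x α β, eta α x (xi β x) = if α = β then 1 else 0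
  f_xi : ∀ x α, f x (xi α x) = 0
  eta_f : ∀ x α v, eta α x (f x v) = 0
  inner_f_f : ∀ x (v w : TangentSpace I x),
    ⟪f x v, f x w⟫_ℝ = ⟪v, w⟫_ℝ - ∑ α, eta α x v * eta α x w

section FStructure

variable {E : Type*} [NormedAddCommGroup E] [NormedSpace ℝ E]
  {H : Type*} [TopologicalSpace H] {I : ModelWithCorners ℝ E H}
  {M : Type*} [TopologicalSpace M] [ChartedSpace H M]

/-- The exterior derivative of a 1-form on vector fields, in the normalization
`2 dη(X, Y) = X(η(Y)) - Y(η(X)) - η([X, Y])`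
that is used for contact metric structures and their generalizations. -/
def dOneForm (eta : Π x : M, TangentSpace I x →L[ℝ] ℝ) (X Y : Π x : M, TangentSpace I x)
    (x : M) : ℝ :=
  (1 / 2) * (mvfderiv I (fun y ↦ eta y (Y y)) x (X x) - mvfderiv I (fun y ↦ eta y (X y)) x (Y x)
    - eta x (mlieBracket I X Y x))

/-- The Nijenhuis torsion `[f, f](X, Y) = f²[X, Y] + [fX, fY] - f[fX, Y] - f[X, fY]`. -/
def nijenhuis (f : Π x : M, TangentSpace I x →L[ℝ] TangentSpace I x)
    (X Y : Π x : M, TangentSpace I x) (x : M) : TangentSpace I x :=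
  f x (f x (mlieBracket I X Y x)) + mlieBracket I (fun y ↦ f y (X y)) (fun y ↦ f y (Y y)) x
    - f x (mlieBracket I (fun y ↦ f y (X y)) Y x) - f x (mlieBracket I X (fun y ↦ f y (Y y)) x)

variable [IsManifold I 1 M] [RiemannianBundle (fun x : M ↦ TangentSpace I x)] {s : ℕ}

namespace MetricFStructure

variable (S : MetricFStructure I M s)

/-- The fundamental 2-form `Φ(X, Y) = g(X, fY)`. -/
def fundamentalForm (X Y : Π x : M, TangentSpace I x) (x : M) : ℝ :=
  ⟪X x, S.f x (Y x)⟫_ℝ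

/-- Normality: `[f, f] + 2 ∑ dη^α ⊗ ξ_α = 0`. -/
def IsNormal : Prop :=
  ∀ X Y : Π x : M, TangentSpace I x, IsSmoothVectorField X → IsSmoothVectorField Y →
    ∀ x, nijenhuis S.f X Y x + (2 : ℝ) • ∑ α, dOneForm (S.eta α) X Y x • S.xi α x = 0

/-- An `S`-structure: a normal metric `f`-structure with `Φ = dη^α` for all `α`. The condition
`η^1 ∧ … ∧ η^s ∧ (dη^α)^n ≠ 0` on a manifold of dimension `2n + s` is then automatic, because
`Φ = dη^α` is nondegenerate on the common kernel of the `η^β`. -/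
structure IsSStructure : Prop where
  normal : S.IsNormal
  d_eta : ∀ α, ∀ X Y : Π x : M, TangentSpace I x, IsSmoothVectorField X → IsSmoothVectorField Y →
    ∀ x, S.fundamentalForm X Y x = dOneForm (S.eta α) X Y x

/-- The distribution `𝓛`: the orthogonal complement of the structure vector fields. -/
def distL (x : M) : Submodule ℝ (TangentSpace I x) :=
  (Submodule.span ℝ (Set.range fun α ↦ S.xi α x))ᗮ

/-- The `𝓛`-sectional curvature of the connection `nabla` is constant, equal to `c`. -/
def HasConstantLSectionalCurvature
    (nabla : CovariantDerivative I E (fun x : M ↦ TangentSpace I x)) (c : ℝ) : Prop :=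
  ∀ (x : M) (u v : TangentSpace I x), u ∈ S.distL x → v ∈ S.distL x →
    ‖u‖ = 1 → ‖v‖ = 1 → ⟪u, v⟫_ℝ = 0 → sectionalCurvature nabla x u v = c

/-- The `f`-sectional curvature of the connection `nabla` is constant, equal to `c`: every plane
spanned by a unit vector `u ∈ 𝓛` and `f u` has sectional curvature `c`. -/
def HasConstantFSectionalCurvature
    (nabla : CovariantDerivative I E (fun x : M ↦ TangentSpace I x)) (c : ℝ) : Prop :=
  ∀ (x : M) (u : TangentSpace I x), u ∈ S.distL x → ‖u‖ = 1 →
    sectionalCurvature nabla x u (S.f x u) = c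

/-- The semi-symmetric metric connection
`∇*_X Y = ∇_X Y + ∑_j η^j(Y) X - ∑_j g(X, Y) ξ_j` associated with `∇ = nabla`
(see `semiSymmetric_apply`). -/
def semiSymmetric (nabla : CovariantDerivative I E (fun x : M ↦ TangentSpace I x)) :
    CovariantDerivative I E (fun x : M ↦ TangentSpace I x) where
  toFun Y x := nabla Y x
    + ∑ j, S.eta j x (Y x) • ContinuousLinearMap.id ℝ (TangentSpace I x)
    - ∑ j, (innerSL ℝ (Y x)).smulRight (S.xi j x)
  isCovariantDerivativeOnUniv :=
    { add := by
        intro Y Y' x hY hY' _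
        ext v
        simp [nabla.isCovariantDerivativeOnUniv.add hY hY', add_smul,
          Finset.sum_add_distrib]
        abel
      leibniz := by
        intro Y h x hY hh _
        ext v
        simp [nabla.isCovariantDerivativeOnUniv.leibniz hY hh, mul_smul,
          ← Finset.smul_sum]
        module }

theorem semiSymmetric_apply (nabla : CovariantDerivative I E (fun x : M ↦ TangentSpace I x))
    (X Y : Π x : M, TangentSpace I x) (x : M) :
    S.semiSymmetric nabla Y x (X x) =
      nabla Y x (X x) + ∑ j, S.eta j x (Y x) • X x - ∑ j, ⟪X x, Y x⟫_ℝ • S.xi j x := by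
  simp [semiSymmetric, real_inner_comm]

end MetricFStructure

end FStructure

end

noncomputable section

/-! ### Linear algebra of `S`-structures at a point -/

section LinearFStructure

variable {V : Type*} [NormedAddCommGroup V] [InnerProductSpace ℝ V] {s : ℕ}

/-- The linear algebra of a metric `f`-structure on one tangent space, with the dual 1-forms
expressed as `η^α(v) = ⟪v, ξ_α⟫`. -/
structure IsLinearFStructure (f : V →ₗ[ℝ] V) (ξ : Fin s → V) : Prop where
  f_f : ∀ v, f (f v) = -v + ∑ α, ⟪v, ξ α⟫_ℝ • ξ α
  f_xi : ∀ α, f (ξ α) = 0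
  xi_xi : ∀ α β, ⟪ξ α, ξ β⟫_ℝ = if α = β then 1 else 0
  skew : ∀ v w, ⟪f v, w⟫_ℝ = -⟪v, f w⟫_ℝ

/-- The pointwise identities satisfied by the first covariant derivatives `A X Y = (∇_X f) Y` and
`N α X = ∇_X ξ_α` of an `S`-structure. -/
structure IsFirstOrderSStructure (f : V →ₗ[ℝ] V) (ξ : Fin s → V) (A : V →ₗ[ℝ] V →ₗ[ℝ] V)
    (N : Fin s → V →ₗ[ℝ] V) : Prop extends IsLinearFStructure f ξ where
  A_skew : ∀ X Y Z, ⟪A X Y, Z⟫_ℝ = -⟪Y, A X Z⟫_ℝ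
  A_f : ∀ X Y, A X (f Y) + f (A X Y) = ∑ α, (⟪N α X, Y⟫_ℝ • ξ α + ⟪Y, ξ α⟫_ℝ • N α X)
  A_xi : ∀ X α, A X (ξ α) = -f (N α X)
  N_xi : ∀ X α β, ⟪N α X, ξ β⟫_ℝ = -⟪N β X, ξ α⟫_ℝ
  normal : ∀ X Y, A (f X) Y - A (f Y) X - f (A X Y) + f (A Y X)
    + (2 : ℝ) • ∑ α, ⟪X, f Y⟫_ℝ • ξ α = 0
  d_eta : ∀ X Y α, ⟪N α X, Y⟫_ℝ - ⟪N α Y, X⟫_ℝ = 2 * ⟪X, f Y⟫_ℝ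
  d_fundamental : ∀ X Y Z, ⟪A X Y, Z⟫_ℝ + ⟪A Y Z, X⟫_ℝ + ⟪A Z X, Y⟫_ℝ = 0

namespace IsLinearFStructure

variable {f : V →ₗ[ℝ] V} {ξ : Fin s → V} (h : IsLinearFStructure f ξ)
include h

theorem inner_f_xi (v : V) (α : Fin s) : ⟪f v, ξ α⟫_ℝ = 0 := by
  rw [h.skew, h.f_xi, inner_zero_right, neg_zero]

theorem inner_xi_f (v : V) (α : Fin s) : ⟪ξ α, f v⟫_ℝ = 0 := by
  rw [real_inner_comm, h.inner_f_xi]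

theorem inner_f_f (v w : V) : ⟪f v, f w⟫_ℝ = ⟪v, w⟫_ℝ - ∑ α, ⟪v, ξ α⟫_ℝ * ⟪w, ξ α⟫_ℝ := by
  rw [h.skew, h.f_f, inner_add_right, inner_neg_right, inner_sum]
  simp only [inner_smul_right]
  have : ∑ α, ⟪w, ξ α⟫_ℝ * ⟪v, ξ α⟫_ℝ = ∑ α, ⟪v, ξ α⟫_ℝ * ⟪w, ξ α⟫_ℝ :=
    Finset.sum_congr rfl fun α _ ↦ mul_comm _ _
  rw [this]; ring

theorem eq_of_f_f (v : V) : v = -f (f v) + ∑ α, ⟪v, ξ α⟫_ℝ • ξ α := by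
  rw [h.f_f]; abel

end IsLinearFStructure

namespace IsFirstOrderSStructure

variable {f : V →ₗ[ℝ] V} {ξ : Fin s → V} {A : V →ₗ[ℝ] V →ₗ[ℝ] V} {N : Fin s → V →ₗ[ℝ] V}
  (h : IsFirstOrderSStructure f ξ A N)
include h

theorem inner_N_xi_symm (α β : Fin s) (Y : V) : ⟪N α (ξ β), Y⟫_ℝ = ⟪N α Y, ξ β⟫_ℝ := by
  have := h.d_eta (ξ β) Y α
  rw [h.inner_xi_f] at this
  linarith

theorem N_xi_antisymm (α β : Fin s) : N α (ξ β) = -N β (ξ α) := by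
  refine ext_inner_right ℝ fun Y ↦ ?_
  rw [inner_neg_left, h.inner_N_xi_symm, h.inner_N_xi_symm, h.N_xi]

theorem N_xi_eq_zero (α β : Fin s) : N α (ξ β) = 0 := by
  have h1 := h.normal (ξ β) (ξ α)
  simp only [h.f_xi, map_zero, LinearMap.zero_apply, inner_zero_right, zero_smul,
    Finset.sum_const_zero, smul_zero, h.A_xi, map_neg, N_xi_antisymm h β α] at h1
  have h2 : f (f (N α (ξ β))) = 0 := by
    have : (2 : ℝ) • f (f (N α (ξ β))) = 0 := by
      rw [← h1]; module
    simpa using this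
  have h3 : ∀ γ, ⟪N α (ξ β), ξ γ⟫_ℝ = 0 := by
    intro γ
    have e1 := h.N_xi (ξ β) α γ
    have e2 := h.inner_N_xi_symm γ β (ξ α)
    have e3 := h.N_xi (ξ α) γ β
    have e4 := h.inner_N_xi_symm β α (ξ γ)
    have e5 := h.N_xi (ξ γ) β α
    have e6 := h.inner_N_xi_symm α β (ξ γ)
    linarith
  rw [h.eq_of_f_f (N α (ξ β)), h2]
  simp [h3]

theorem inner_N_f_f (α : Fin s) (X Y : V) : ⟪N α (f X), f Y⟫_ℝ = -⟪N α (f Y), f X⟫_ℝ := by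
  have h1 := congrArg (fun v ↦ ⟪v, f (f Y)⟫_ℝ) (h.normal X (ξ α))
  simp only [h.f_xi, map_zero, LinearMap.zero_apply, inner_zero_right, zero_smul,
    Finset.sum_const_zero, smul_zero, h.A_xi, map_neg, inner_sub_left, inner_add_left,
    inner_neg_left, inner_zero_left] at h1
  simp only [fun v ↦ h.inner_f_f v (f Y), h.inner_f_xi, mul_zero, Finset.sum_const_zero] at h1
  have h2 := h.d_fundamental (ξ α) X (f Y)
  rw [h.A_skew X, h.A_xi, h.A_xi, inner_neg_right, inner_neg_left, h.skew (N α (f Y)),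
    real_inner_comm (f (N α X))] at h2
  linarith

theorem inner_N_antisymm (α : Fin s) (X Y : V) : ⟪N α X, Y⟫_ℝ = -⟪N α Y, X⟫_ℝ := by
  have hN : ∀ X, N α X = -N α (f (f X)) := by
    intro X
    conv_lhs => rw [h.eq_of_f_f X]
    simp [h.N_xi_eq_zero]
  have hxi : ∀ X β, ⟪N α X, ξ β⟫_ℝ = 0 := by
    intro X β
    rw [← h.inner_N_xi_symm, h.N_xi_eq_zero, inner_zero_left]
  have key : ∀ X Y, ⟪N α X, Y⟫_ℝ = ⟪N α (f (f X)), f (f Y)⟫_ℝ := by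
    intro X Y
    conv_lhs => rw [h.eq_of_f_f Y, hN X]
    simp [inner_add_right, inner_sum, inner_smul_right, hxi]
  rw [key, key Y X, h.inner_N_f_f]

/-- `∇_X ξ_α = -fX`. -/
theorem N_eq (α : Fin s) (X : V) : N α X = -f X := by
  refine ext_inner_right ℝ fun Y ↦ ?_
  have h1 := h.d_eta X Y α
  have h2 := h.inner_N_antisymm α X Y
  rw [inner_neg_left, h.skew]
  linarith

/-- `(∇_X f) Y = ∑ (g(fX, fY) ξ_α + η^α(Y) f²X)`. -/
theorem A_eq (X Y : V) :
    A X Y = ⟪f X, f Y⟫_ℝ • ∑ α, ξ α + ⟪Y, ∑ α, ξ α⟫_ℝ • f (f X) := by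
  set P := ∑ α, ξ α with hP
  have hAf : ∀ X Y, A X (f Y) = -f (A X Y) - ⟪f X, Y⟫_ℝ • P - ⟪Y, P⟫_ℝ • f X := by
    intro X Y
    have h1 := h.A_f X Y
    simp only [h.N_eq, inner_neg_left, smul_neg, neg_smul, Finset.sum_add_distrib,
      Finset.sum_neg_distrib, ← Finset.smul_sum, ← Finset.sum_smul, ← inner_sum, ← hP] at h1
    rw [eq_sub_of_add_eq h1]
    abel
  have hxi : ∀ X Y α, ⟪A X Y, ξ α⟫_ℝ = ⟪f X, f Y⟫_ℝ := by
    intro X Y α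
    rw [h.A_skew, h.A_xi, h.N_eq, map_neg, neg_neg, real_inner_comm, h.skew, neg_neg]
  have hff : ∀ X Y Z, ⟪f (A X Y), f Z⟫_ℝ = ⟪A X Y, Z⟫_ℝ - ⟪f X, f Y⟫_ℝ * ⟪Z, P⟫_ℝ := by
    intro X Y Z
    rw [h.inner_f_f, hP, inner_sum, Finset.mul_sum]
    simp [hxi]
  have hPf : ∀ X, ⟪P, f X⟫_ℝ = 0 := by
    intro X
    simp [hP, sum_inner, h.inner_xi_f]
  refine ext_inner_right ℝ fun Z ↦ ?_
  have e1 := congrArg (fun v ↦ ⟪v, f X⟫_ℝ) (h.normal Y Z)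
  simp only [inner_sub_left, inner_add_left, inner_smul_left, sum_inner, h.inner_xi_f, mul_zero,
    Finset.sum_const_zero, inner_zero_left, hff, add_zero] at e1
  have swap : ∀ U X Z, ⟪A U Z, f X⟫_ℝ = -⟪A U X, f Z⟫_ℝ + ⟪f U, X⟫_ℝ * ⟪Z, P⟫_ℝ
      + ⟪X, P⟫_ℝ * ⟪f U, Z⟫_ℝ := by
    intro U X Z
    rw [h.A_skew, hAf, inner_sub_right, inner_sub_right, inner_neg_right, inner_smul_right,
      inner_smul_right, real_inner_comm (f (A U X)) Z, h.skew (A U X), real_inner_comm (f U) Z]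
    ring
  have e2 := swap (f Y) X Z
  have e3 := swap (f Z) X Y
  have e4 := h.d_fundamental X (f Y) (f Z)
  have e5 := h.d_fundamental X Y Z
  have e6 : ⟪A X (f Y), f Z⟫_ℝ = -⟪f (A X Y), f Z⟫_ℝ - ⟪Y, P⟫_ℝ * ⟪f X, f Z⟫_ℝ := by
    rw [hAf]
    simp [inner_sub_left, inner_smul_left, hPf]
  rw [hff] at e6
  have e7 : ⟪A (f Y) (f Z), X⟫_ℝ = -⟪A (f Y) X, f Z⟫_ℝ := by rw [h.A_skew, real_inner_comm]
  have e8 : ⟪A Z X, Y⟫_ℝ = -⟪A Z Y, X⟫_ℝ := by rw [h.A_skew, real_inner_comm]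
  have c1 := h.skew (f Y) X
  have c2 := h.skew (f Z) X
  have c3 := h.skew (f Y) Z
  have c4 := h.skew (f Z) Y
  have c5 := h.skew (f X) Z
  rw [inner_add_left, inner_smul_left, inner_smul_left, c5, real_inner_comm Z P]
  simp only [conj_trivial]
  rw [c1, c3] at e2
  rw [c2, c4] at e3
  simp only [real_inner_comm (f X) (f Y), real_inner_comm (f X) (f Z),
    real_inner_comm (f Z) (f Y)] at *
  linarith

end IsFirstOrderSStructure

end LinearFStructure

/-! ### Algebraic curvature tensors of `S`-structures -/

section AlgebraicCurvature

variable {V : Type*} [NormedAddCommGroup V] [InnerProductSpace ℝ V] {s : ℕ}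

/-- A `4`-linear form with the symmetries of the curvature tensor `g(R(X, Y) Z, W)` of a
Riemannian metric. -/
structure IsAlgebraicCurvature (T : V →ₗ[ℝ] V →ₗ[ℝ] V →ₗ[ℝ] V →ₗ[ℝ] ℝ) : Prop where
  swap_left : ∀ X Y Z W, T X Y Z W = -T Y X Z W
  swap_right : ∀ X Y Z W, T X Y Z W = -T X Y W Z
  bianchi : ∀ X Y Z W, T X Y Z W + T Y Z X W + T Z X Y W = 0

theorem IsAlgebraicCurvature.pair_symm {T : V →ₗ[ℝ] V →ₗ[ℝ] V →ₗ[ℝ] V →ₗ[ℝ] ℝ}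
    (hT : IsAlgebraicCurvature T) (X Y Z W : V) : T X Y Z W = T Z W X Y := by
  have b1 := hT.bianchi X Y Z W
  have b2 := hT.bianchi Y Z W X
  have b3 := hT.bianchi Z W X Y
  have b4 := hT.bianchi W X Y Z
  have := hT.swap_right X Y Z W
  have := hT.swap_right Y Z X W
  have := hT.swap_right Z X Y W
  have := hT.swap_right Z W Y X
  have := hT.swap_right W Y Z X
  have := hT.swap_right W X Z Y
  have := hT.swap_left Z X Y W
  have := hT.swap_left Z X W Y
  have := hT.swap_left Y W Z X
  have := hT.swap_left Y W X Z
  linarith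

/-- The identities satisfied by the curvature tensor of an `S`-structure at a point, besides the
symmetries of a Riemannian curvature tensor. -/
structure IsSCurvature (f : V →ₗ[ℝ] V) (ξ : Fin s → V)
    (T : V →ₗ[ℝ] V →ₗ[ℝ] V →ₗ[ℝ] V →ₗ[ℝ] ℝ) : Prop
    extends IsLinearFStructure f ξ, IsAlgebraicCurvature T where
  apply_xi : ∀ X Y W α, T X Y (ξ α) W =
    ⟪Y, ∑ β, ξ β⟫_ℝ * ⟪f X, f W⟫_ℝ - ⟪X, ∑ β, ξ β⟫_ℝ * ⟪f Y, f W⟫_ℝ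
  apply_f : ∀ X Y Z W, (∀ α, ⟪X, ξ α⟫_ℝ = 0) → (∀ α, ⟪Y, ξ α⟫_ℝ = 0) → (∀ α, ⟪Z, ξ α⟫_ℝ = 0) →
    (∀ α, ⟪W, ξ α⟫_ℝ = 0) → T X Y (f Z) W + T X Y Z (f W) =
      s * (-⟪Y, Z⟫_ℝ * ⟪f X, W⟫_ℝ + ⟪X, Z⟫_ℝ * ⟪f Y, W⟫_ℝ - ⟪X, f Z⟫_ℝ * ⟪Y, W⟫_ℝ
        + ⟪Y, f Z⟫_ℝ * ⟪X, W⟫_ℝ)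

namespace IsLinearFStructure

variable {f : V →ₗ[ℝ] V} {ξ : Fin s → V} (h : IsLinearFStructure f ξ)
include h

theorem f_f_of_horizontal {X : V} (hX : ∀ α, ⟪X, ξ α⟫_ℝ = 0) : f (f X) = -X := by
  simp [h.f_f, hX]

theorem inner_f_f_of_horizontal {X : V} (hX : ∀ α, ⟪X, ξ α⟫_ℝ = 0) (Y : V) :
    ⟪f X, f Y⟫_ℝ = ⟪X, Y⟫_ℝ := by
  simp [h.inner_f_f, hX]

theorem inner_self_f (X : V) : ⟪X, f X⟫_ℝ = 0 := by
  have := h.skew X X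
  rw [real_inner_comm] at this
  linarith

theorem inner_f_sum_xi (X : V) : ⟪f X, ∑ α, ξ α⟫_ℝ = 0 := by
  simp [inner_sum, h.inner_f_xi]

theorem inner_sum_xi_self : ⟪∑ α, ξ α, ∑ α, ξ α⟫_ℝ = s := by
  simp only [inner_sum, sum_inner, h.xi_xi]
  simp

theorem inner_proj_proj (X Y : V) : ⟪-f (f X), -f (f Y)⟫_ℝ = ⟪f X, f Y⟫_ℝ := by
  rw [inner_neg_neg, h.inner_f_f_of_horizontal (h.inner_f_xi X)]

end IsLinearFStructure

theorem horizontal_of_unit {f : V →ₗ[ℝ] V} {ξ : Fin s → V}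
    {T : V →ₗ[ℝ] V →ₗ[ℝ] V →ₗ[ℝ] V →ₗ[ℝ] ℝ} {c : ℝ}
    (hc : ∀ X, (∀ α, ⟪X, ξ α⟫_ℝ = 0) → ‖X‖ = 1 → T X (f X) (f X) X = c)
    (X : V) (hX : ∀ α, ⟪X, ξ α⟫_ℝ = 0) : T X (f X) (f X) X = c * ⟪X, X⟫_ℝ ^ 2 := by
  by_cases h0 : X = 0
  · simp [h0]
  have hn : ‖X‖ ≠ 0 := norm_ne_zero_iff.mpr h0
  have := hc (‖X‖⁻¹ • X) (fun α ↦ by rw [inner_smul_left, hX, mul_zero])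
    (by rw [norm_smul, norm_inv, norm_norm, inv_mul_cancel₀ hn])
  simp only [map_smul, LinearMap.smul_apply, smul_eq_mul] at this
  rw [← this, real_inner_self_eq_norm_sq]
  field_simp

namespace IsSCurvature

variable {f : V →ₗ[ℝ] V} {ξ : Fin s → V} {T : V →ₗ[ℝ] V →ₗ[ℝ] V →ₗ[ℝ] V →ₗ[ℝ] ℝ}
  (h : IsSCurvature f ξ T)
include h

theorem apply_f_f {X Y Z W : V} (hX : ∀ α, ⟪X, ξ α⟫_ℝ = 0) (hY : ∀ α, ⟪Y, ξ α⟫_ℝ = 0)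
    (hZ : ∀ α, ⟪Z, ξ α⟫_ℝ = 0) (hW : ∀ α, ⟪W, ξ α⟫_ℝ = 0) :
    T X Y (f Z) (f W) = T X Y Z W + s * (-⟪Y, Z⟫_ℝ * ⟪X, W⟫_ℝ + ⟪X, Z⟫_ℝ * ⟪Y, W⟫_ℝ
      - ⟪X, f Z⟫_ℝ * ⟪Y, f W⟫_ℝ + ⟪Y, f Z⟫_ℝ * ⟪X, f W⟫_ℝ) := by
  have := h.apply_f X Y Z (f W) hX hY hZ (h.inner_f_xi W)
  rw [h.f_f_of_horizontal hW, h.inner_f_f_of_horizontal hX, h.inner_f_f_of_horizontal hY,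
    map_neg] at this
  linarith

theorem polarization {c : ℝ}
    (hc : ∀ X, (∀ α, ⟪X, ξ α⟫_ℝ = 0) → T X (f X) (f X) X = c * ⟪X, X⟫_ℝ ^ 2)
    {X Y : V} (hX : ∀ α, ⟪X, ξ α⟫_ℝ = 0) (hY : ∀ α, ⟪Y, ξ α⟫_ℝ = 0) :
    T X Y Y X - s * (⟪X, X⟫_ℝ * ⟪Y, Y⟫_ℝ - ⟪X, Y⟫_ℝ ^ 2)
      + 3 * (T X (f Y) (f Y) X - s * (⟪X, X⟫_ℝ * ⟪Y, Y⟫_ℝ - ⟪X, f Y⟫_ℝ ^ 2)) =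
    (c - s) * (⟪X, X⟫_ℝ * ⟪Y, Y⟫_ℝ + 2 * ⟪X, Y⟫_ℝ ^ 2) := by
  have hp := hc (X + Y) fun α ↦ by rw [inner_add_left, hX, hY, add_zero]
  have hm := hc (X + (-1 : ℝ) • Y) fun α ↦ by
    rw [inner_add_left, inner_smul_left, hX, hY, mul_zero, add_zero]
  have h1 := hc X hX
  have h2 := hc Y hY
  simp only [map_add, map_smul, LinearMap.add_apply, LinearMap.smul_apply, inner_add_left,
    inner_add_right, real_inner_smul_left, real_inner_smul_right, smul_eq_mul] at hp hm
  have hfX := h.inner_f_xi X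
  have hfY := h.inner_f_xi Y
  have c0 := real_inner_comm X Y
  have c1 : ⟪f X, Y⟫_ℝ = -⟪X, f Y⟫_ℝ := h.skew X Y
  have c2 : ⟪f Y, X⟫_ℝ = ⟪X, f Y⟫_ℝ := real_inner_comm _ _
  have c3 : ⟪Y, f X⟫_ℝ = -⟪X, f Y⟫_ℝ := by rw [real_inner_comm, c1]
  have c4 := h.inner_self_f X
  have c5 := h.inner_self_f Y
  have c6 : ⟪f X, X⟫_ℝ = 0 := by rw [real_inner_comm, c4]
  have c7 : ⟪f Y, Y⟫_ℝ = 0 := by rw [real_inner_comm, c5]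
  have c8 := h.inner_f_f_of_horizontal hX Y
  have c9 := h.inner_f_f_of_horizontal hX X
  have c10 := h.inner_f_f_of_horizontal hY Y
  have c11 : ⟪f Y, f X⟫_ℝ = ⟪X, Y⟫_ℝ := by rw [real_inner_comm, c8]
  have d1 := h.f_f_of_horizontal hX
  have d2 := h.f_f_of_horizontal hY
  -- every mixed term is expressed through `T X Y Y X` and `T X (f Y) (f Y) X`
  have t1 : T Y (f Y) (f X) X = T X (f X) (f Y) Y := by
    rw [h.pair_symm, h.swap_left, h.swap_right, neg_neg]
  have t2 := h.apply_f_f hY hfX hY hfX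
  have t3 := h.apply_f_f hX hfY hfY hX
  have t4 := h.apply_f_f hX hfY hX hfY
  have t5 := h.pair_symm Y (f X) X (f Y)
  have t6 := h.bianchi X (f X) (f Y) Y
  have t7 := h.apply_f_f hX hY hX hY
  have t8 := h.pair_symm (f X) (f Y) X Y
  have t9 := h.swap_left (f Y) X (f X) Y
  have t10 := h.swap_right X Y X Y
  have t11 := h.swap_right Y (f X) (f X) Y
  have t12 := h.swap_right X (f Y) (f Y) X
  have t13 := h.swap_right Y (f X) (f Y) X
  have t14 := h.swap_right X (f Y) (f X) Y
  simp only [d1, d2, map_neg, inner_neg_right, c1, c2, c3, c4, c5, c6, c7, c8, c9, c10, c11, c0]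
    at *
  linarith

theorem apply_horizontal {c : ℝ}
    (hc : ∀ X, (∀ α, ⟪X, ξ α⟫_ℝ = 0) → T X (f X) (f X) X = c * ⟪X, X⟫_ℝ ^ 2)
    {X Y : V} (hX : ∀ α, ⟪X, ξ α⟫_ℝ = 0) (hY : ∀ α, ⟪Y, ξ α⟫_ℝ = 0) :
    T X Y Y X = (c + 3 * s) / 4 * (⟪X, X⟫_ℝ * ⟪Y, Y⟫_ℝ - ⟪X, Y⟫_ℝ ^ 2)
      + 3 * (c - s) / 4 * ⟪X, f Y⟫_ℝ ^ 2 := by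
  have h1 := h.polarization hc hX hY
  have h2 := h.polarization hc hX (h.inner_f_xi Y)
  simp only [h.f_f_of_horizontal hY, h.inner_f_f_of_horizontal hY, map_neg, LinearMap.neg_apply,
    inner_neg_right, neg_neg, neg_sq] at h2
  linarith

/-- The curvature form `g(R(X, Y) Y, X)` of an `S`-space-form. -/
theorem apply_eq {c : ℝ}
    (hc : ∀ X, (∀ α, ⟪X, ξ α⟫_ℝ = 0) → T X (f X) (f X) X = c * ⟪X, X⟫_ℝ ^ 2) (X Y : V) :
    T X Y Y X = (c + 3 * s) / 4 * (⟪f X, f X⟫_ℝ * ⟪f Y, f Y⟫_ℝ - ⟪f X, f Y⟫_ℝ ^ 2)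
      + 3 * (c - s) / 4 * ⟪X, f Y⟫_ℝ ^ 2
      + (⟪Y, ∑ α, ξ α⟫_ℝ ^ 2 * ⟪f X, f X⟫_ℝ
        - 2 * ⟪X, ∑ α, ξ α⟫_ℝ * ⟪Y, ∑ α, ξ α⟫_ℝ * ⟪f X, f Y⟫_ℝ
        + ⟪X, ∑ α, ξ α⟫_ℝ ^ 2 * ⟪f Y, f Y⟫_ℝ) := by
  have hproj : ∀ X : V, ∀ α, ⟪-f (f X), ξ α⟫_ℝ = 0 := fun X α ↦ by
    rw [inner_neg_left, h.inner_f_xi, neg_zero]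
  have hff : ∀ X : V, f (-f (f X)) = f X := fun X ↦ by
    rw [map_neg, h.f_f_of_horizontal (h.inner_f_xi X), neg_neg]
  have key := h.apply_horizontal hc (hproj X) (hproj Y)
  rw [h.inner_proj_proj, h.inner_proj_proj, h.inner_proj_proj, hff] at key
  have hw : ⟪-f (f X), f Y⟫_ℝ = ⟪X, f Y⟫_ℝ := by
    rw [inner_neg_left, h.inner_f_f_of_horizontal (h.inner_f_xi X), h.skew, neg_neg]
  have hcomp : ∀ A B Z W : V, T A B Z W = T A B (-f (f Z)) W
      + ⟪Z, ∑ α, ξ α⟫_ℝ * (⟪B, ∑ β, ξ β⟫_ℝ * ⟪f A, f W⟫_ℝ - ⟪A, ∑ β, ξ β⟫_ℝ * ⟪f B, f W⟫_ℝ) := by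
    intro A B Z W
    conv_lhs => rw [h.eq_of_f_f Z]
    simp only [map_add, map_sum, map_smul, LinearMap.add_apply, LinearMap.sum_apply,
      LinearMap.smul_apply, smul_eq_mul, h.apply_xi]
    rw [← Finset.sum_mul, ← inner_sum]
  have hzero : ∀ X : V, ⟪-f (f X), ∑ α, ξ α⟫_ℝ = 0 := fun X ↦ by
    rw [inner_neg_left, h.inner_f_sum_xi, neg_zero]
  have e1 := hcomp X Y Y X
  have e2 := h.swap_right X Y (-f (f Y)) X
  have e3 := hcomp X Y X (-f (f Y))
  have e4 := h.pair_symm X Y (-f (f X)) (-f (f Y))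
  have e5 := hcomp (-f (f X)) (-f (f Y)) X Y
  have e6 := h.swap_right (-f (f X)) (-f (f Y)) (-f (f X)) Y
  have e7 := hcomp (-f (f X)) (-f (f Y)) Y (-f (f X))
  have e8 := h.swap_right (-f (f X)) (-f (f Y)) (-f (f Y)) (-f (f X))
  rw [hff] at e3
  simp only [hzero, zero_mul, sub_self, mul_zero, add_zero] at e5 e7
  rw [hw] at key
  rw [real_inner_comm (f X) (f Y)] at e1
  nlinarith

end IsSCurvature

end AlgebraicCurvature

section ScalarCurvature

variable {V : Type*} [NormedAddCommGroup V] [InnerProductSpace ℝ V] {s : ℕ}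

theorem OrthonormalBasis.sum_inner_mul_inner' {ι : Type*} [Fintype ι] (e : OrthonormalBasis ι ℝ V)
    (x y : V) : ∑ i, ⟪e i, x⟫_ℝ * ⟪e i, y⟫_ℝ = ⟪x, y⟫_ℝ := by
  rw [← e.sum_inner_mul_inner x y]
  exact Finset.sum_congr rfl fun i _ ↦ by rw [real_inner_comm]

namespace IsLinearFStructure

variable {f : V →ₗ[ℝ] V} {ξ : Fin s → V} (h : IsLinearFStructure f ξ)
  {ι : Type*} [Fintype ι] (e : OrthonormalBasis ι ℝ V)
include h

theorem sum_inner_f_f_self :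
    ∑ i, ⟪f (e i), f (e i)⟫_ℝ = Fintype.card ι - s := by
  simp only [h.inner_f_f, Finset.sum_sub_distrib]
  rw [Finset.sum_comm]
  simp only [e.sum_inner_mul_inner', h.xi_xi]
  simp [e.orthonormal.1]

theorem sum_inner_f_f_sq (u : V) : ∑ j, ⟪f u, f (e j)⟫_ℝ ^ 2 = ⟪f u, f u⟫_ℝ := by
  rw [← h.inner_proj_proj, ← e.sum_inner_mul_inner']
  refine Finset.sum_congr rfl fun j _ ↦ ?_
  rw [inner_neg_right, ← h.skew, real_inner_comm, sq]

theorem sum_inner_f_sq (u : V) : ∑ j, ⟪u, f (e j)⟫_ℝ ^ 2 = ⟪f u, f u⟫_ℝ := by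
  rw [← e.sum_inner_mul_inner']
  refine Finset.sum_congr rfl fun j _ ↦ ?_
  rw [← neg_sq, ← h.skew, real_inner_comm, sq]

theorem sum_inner_sum_xi_sq : ∑ j, ⟪e j, ∑ α, ξ α⟫_ℝ ^ 2 = s := by
  simp only [sq, e.sum_inner_mul_inner', h.inner_sum_xi_self]

theorem sum_inner_sum_xi_mul_inner_f_f (u : V) :
    ∑ j, ⟪e j, ∑ α, ξ α⟫_ℝ * ⟪f u, f (e j)⟫_ℝ = 0 := by
  have : ∀ j, ⟪f u, f (e j)⟫_ℝ = ⟪e j, -f (f u)⟫_ℝ := fun j ↦ by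
    rw [inner_neg_right, ← h.skew, real_inner_comm]
  simp only [this, e.sum_inner_mul_inner']
  rw [inner_neg_right, real_inner_comm, h.inner_f_sum_xi, neg_zero]

end IsLinearFStructure

namespace IsSCurvature

variable {f : V →ₗ[ℝ] V} {ξ : Fin s → V} {T : V →ₗ[ℝ] V →ₗ[ℝ] V →ₗ[ℝ] V →ₗ[ℝ] ℝ}
  (h : IsSCurvature f ξ T)
include h

/-- The scalar curvature of the semi-symmetric metric connection of an `S`-space-form. -/
theorem half_sum_semiSymmetric {n : ℕ} {c : ℝ}
    (hc : ∀ X, (∀ α, ⟪X, ξ α⟫_ℝ = 0) → T X (f X) (f X) X = c * ⟪X, X⟫_ℝ ^ 2)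
    (e : OrthonormalBasis (Fin (2 * n + s)) ℝ V) {k : Fin (2 * n + s) → Fin (2 * n + s) → ℝ}
    (hk : ∀ i, k i i = 0)
    (hk' : ∀ i j, i ≠ j → k i j = T (e i) (e j) (e j) (e i) - s + ⟪e i, ∑ α, ξ α⟫_ℝ ^ 2
      + ⟪e j, ∑ α, ξ α⟫_ℝ ^ 2) :
    (1 / 2) * ∑ i, ∑ j, k i j =
      (n * (n + 1) * (c - s) + (4 * n * s + s * (s - 1)) * (2 - s)) / 2 := by
  set P := ∑ α, ξ α with hP
  have key : ∀ i j, k i j =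
      (c + 3 * s) / 4 * (⟪f (e i), f (e i)⟫_ℝ * ⟪f (e j), f (e j)⟫_ℝ - ⟪f (e i), f (e j)⟫_ℝ ^ 2)
      + 3 * (c - s) / 4 * ⟪e i, f (e j)⟫_ℝ ^ 2
      + (⟪e j, P⟫_ℝ ^ 2 * ⟪f (e i), f (e i)⟫_ℝ
        - 2 * (⟪e i, P⟫_ℝ * (⟪e j, P⟫_ℝ * ⟪f (e i), f (e j)⟫_ℝ))
        + ⟪e i, P⟫_ℝ ^ 2 * ⟪f (e j), f (e j)⟫_ℝ)
      + (-s + ⟪e i, P⟫_ℝ ^ 2 + ⟪e j, P⟫_ℝ ^ 2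
        + if i = j then s - 2 * ⟪e i, P⟫_ℝ ^ 2 else 0) := by
    intro i j
    by_cases hij : i = j
    · subst hij
      rw [hk, h.inner_self_f, if_pos rfl]
      ring
    · rw [hk' i j hij, h.apply_eq hc, if_neg hij, ← hP]
      ring
  have hn : ∑ i, ⟪f (e i), f (e i)⟫_ℝ = 2 * n := by
    rw [h.sum_inner_f_f_self]; simp
  simp only [key, Finset.sum_add_distrib, Finset.sum_sub_distrib, ← Finset.mul_sum,
    ← Finset.sum_mul, h.sum_inner_f_f_sq, h.sum_inner_f_sq, hP, h.sum_inner_sum_xi_sq,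
    h.sum_inner_sum_xi_mul_inner_f_f, hn, Finset.sum_ite_eq, Finset.sum_const, Finset.card_univ,
    Fintype.card_fin, nsmul_eq_mul, Finset.mem_univ, if_true, mul_zero]
  push_cast
  ring

end IsSCurvature

/-- On an `S`-structure with `n ≥ 2` there are orthonormal horizontal vectors `u`, `v` with
`g(u, fv) = 0`. -/
theorem IsLinearFStructure.exists_orthonormal {f : V →ₗ[ℝ] V} {ξ : Fin s → V}
    (h : IsLinearFStructure f ξ) [FiniteDimensional ℝ V] {n : ℕ} (hn : 2 ≤ n)
    (hV : Module.finrank ℝ V = 2 * n + s) :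
    ∃ u v : V, (∀ α, ⟪u, ξ α⟫_ℝ = 0) ∧ (∀ α, ⟪v, ξ α⟫_ℝ = 0) ∧ ‖u‖ = 1 ∧ ‖v‖ = 1 ∧
      ⟪u, v⟫_ℝ = 0 ∧ ⟪u, f v⟫_ℝ = 0 := by
  have key : ∀ {k : ℕ} (w : Fin k → V), k < 2 * n + s → ∃ v : V, ‖v‖ = 1 ∧ ∀ i, ⟪v, w i⟫_ℝ = 0 := by
    intro k w hk
    have h1 : Module.finrank ℝ (Submodule.span ℝ (Set.range w)) ≤ k := by
      simpa [Set.finrank] using finrank_range_le_card (R := ℝ) w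
    have h2 := Submodule.finrank_add_finrank_orthogonal (Submodule.span ℝ (Set.range w))
    have h3 : 0 < Module.finrank ℝ (Submodule.span ℝ (Set.range w))ᗮ := by omega
    have := Module.nontrivial_of_finrank_pos h3
    obtain ⟨⟨v, hv⟩, hv0⟩ := exists_ne (0 : (Submodule.span ℝ (Set.range w))ᗮ)
    have hv1 : v ≠ 0 := fun h0 ↦ hv0 (Subtype.ext h0)
    refine ⟨‖v‖⁻¹ • v, norm_smul_inv_norm hv1, fun i ↦ ?_⟩
    rw [real_inner_smul_left, real_inner_comm,
      (Submodule.mem_orthogonal _ _).mp hv _ (Submodule.subset_span ⟨i, rfl⟩), mul_zero]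
  obtain ⟨u, hu, hu'⟩ := key ξ (by omega)
  obtain ⟨v, hv, hv'⟩ := key (Fin.cons u (Fin.cons (f u) ξ) : Fin (s + 2) → V) (by omega)
  refine ⟨u, v, hu', fun α ↦ by simpa using hv' α.succ.succ, hu, hv, ?_, ?_⟩
  · rw [real_inner_comm]; simpa using hv' 0
  · have : ⟪v, f u⟫_ℝ = 0 := by simpa using hv' (Fin.succ 0)
    rw [real_inner_comm] at this
    rw [← neg_eq_zero, ← h.skew, this]

end ScalarCurvature

/-! ### Calculus of smooth vector fields -/

section SmoothFields

open Filter
open scoped Topology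

variable {E : Type*} [NormedAddCommGroup E] [NormedSpace ℝ E]
  {H : Type*} [TopologicalSpace H] {I : ModelWithCorners ℝ E H}
  {M : Type*} [TopologicalSpace M] [ChartedSpace H M] [IsManifold I ∞ M]

namespace IsSmoothVectorField

variable {X Y : Π x : M, TangentSpace I x}

theorem mdifferentiableAt (hX : IsSmoothVectorField X) (x : M) : MDiffAt (T% X) x :=
  (ContMDiff.contMDiffAt hX).mdifferentiableAt (by simp)

theorem add (hX : IsSmoothVectorField X) (hY : IsSmoothVectorField Y) :
    IsSmoothVectorField (X + Y) :=
  ContMDiff.add_section hX hY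

theorem sub (hX : IsSmoothVectorField X) (hY : IsSmoothVectorField Y) :
    IsSmoothVectorField (X - Y) :=
  ContMDiff.sub_section hX hY

theorem neg (hX : IsSmoothVectorField X) : IsSmoothVectorField (-X) :=
  ContMDiff.neg_section hX

theorem smul {h : M → ℝ} (hh : ContMDiff I 𝓘(ℝ) ∞ h) (hX : IsSmoothVectorField X) :
    IsSmoothVectorField (h • X) :=
  ContMDiff.smul_section hh hX

theorem sum {ι : Type*} {s : Finset ι} {X : ι → Π x : M, TangentSpace I x}
    (hX : ∀ i, IsSmoothVectorField (X i)) : IsSmoothVectorField (∑ i ∈ s, X i) := by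
  have : IsSmoothVectorField (fun x ↦ ∑ i ∈ s, X i x) :=
    ContMDiff.sum_section (fun i _ ↦ hX i)
  convert this using 1
  ext x
  simp

end IsSmoothVectorField

section Extension

variable [FiniteDimensional ℝ E]

variable (E I) in
/-- A globally smooth vector field extending the tangent vector `v`; near the base point it is
`FiberBundle.extend E v`. -/
def globalExtend {x : M} (v : TangentSpace I x) : Π y : M, TangentSpace I y :=
  (Classical.arbitrary (SmoothBumpFunction I x) : M → ℝ) • (FiberBundle.extend E v)

theorem globalExtend_smooth [T2Space M] {x : M} (v : TangentSpace I x) :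
    IsSmoothVectorField (globalExtend E I v) := by
  set χ := Classical.arbitrary (SmoothBumpFunction I x)
  refine ContMDiffOn.smul_section_of_tsupport (u := (chartAt H x).source)
    χ.contMDiff.contMDiffOn (chartAt H x).open_source χ.tsupport_subset_chartAt_source ?_
  set t := trivializationAt E (TangentSpace I : M → Type _) x with ht
  have hb : (chartAt H x).source = t.baseSet := by
    rw [ht, TangentBundle.trivializationAt_baseSet]
  rw [hb]
  intro y hy
  rw [t.contMDiffWithinAt_section _ hy]
  have : CMDiff[t.baseSet] ∞ (fun _ : M ↦ (t ⟨x, v⟩).2) := contMDiffOn_const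
  refine (this.congr fun y hy ↦ ?_) y hy
  have h := congrArg Prod.snd (t.apply_mk_symm hy (t ⟨x, v⟩).2)
  exact h

theorem globalExtend_eventuallyEq {x : M} (v : TangentSpace I x) :
    globalExtend E I v =ᶠ[𝓝 x] (FiberBundle.extend E v : Π y : M, TangentSpace I y) := by
  filter_upwards [(Classical.arbitrary (SmoothBumpFunction I x)).eventuallyEq_one] with y hy
  rw [globalExtend, Pi.smul_apply', hy, Pi.one_apply, one_smul]

@[simp]
theorem globalExtend_self {x : M} (v : TangentSpace I x) : globalExtend E I v x = v := by
  rw [(globalExtend_eventuallyEq v).eq_of_nhds]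
  exact FiberBundle.extend_apply_self E v

omit [FiniteDimensional ℝ E] in
theorem extend_eq_symmL {x : M} (v : TangentSpace I x) {y : M}
    (hy : y ∈ (trivializationAt E (TangentSpace I : M → Type _) x).baseSet) :
    (FiberBundle.extend E v : Π y : M, TangentSpace I y) y =
      (trivializationAt E (TangentSpace I : M → Type _) x).symmL ℝ y
      ((trivializationAt E (TangentSpace I : M → Type _) x).continuousLinearMapAt ℝ x v) := by
  set t := trivializationAt E (TangentSpace I : M → Type _) x
  have hx : x ∈ t.baseSet := FiberBundle.mem_baseSet_trivializationAt' x
  rw [t.symmL_apply (R := ℝ) hy, t.continuousLinearMapAt_apply_of_mem (R := ℝ) hx]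
  rfl

theorem globalExtend_add {x : M} (v w : TangentSpace I x) :
    globalExtend E I (v + w) = globalExtend E I v + globalExtend E I w := by
  ext y
  by_cases hy : y ∈ (trivializationAt E (TangentSpace I : M → Type _) x).baseSet
  · simp [globalExtend, extend_eq_symmL _ hy]
  · have : (Classical.arbitrary (SmoothBumpFunction I x)) y = 0 := by
      rw [TangentBundle.trivializationAt_baseSet] at hy
      exact Function.notMem_support.mp fun h ↦
        hy ((Classical.arbitrary (SmoothBumpFunction I x)).support_subset_source h)
    simp [globalExtend, this]

theorem globalExtend_smul {x : M} (c : ℝ) (v : TangentSpace I x) :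
    globalExtend E I (c • v) = c • globalExtend E I v := by
  ext y
  by_cases hy : y ∈ (trivializationAt E (TangentSpace I : M → Type _) x).baseSet
  · simp [globalExtend, extend_eq_symmL _ hy, smul_comm c]
  · have : (Classical.arbitrary (SmoothBumpFunction I x)) y = 0 := by
      rw [TangentBundle.trivializationAt_baseSet] at hy
      exact Function.notMem_support.mp fun h ↦
        hy ((Classical.arbitrary (SmoothBumpFunction I x)).support_subset_source h)
    simp [globalExtend, this]

end Extension

section Functions

theorem contMDiff_mvfderiv {h : M → ℝ} (hh : ContMDiff I 𝓘(ℝ) ∞ h) {X : Π x : M, TangentSpace I x}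
    (hX : IsSmoothVectorField X) : ContMDiff I 𝓘(ℝ) ∞ (fun x ↦ mvfderiv I h x (X x)) := by
  have h1 : ContMDiff I.tangent 𝓘(ℝ).tangent ∞ (tangentMap I 𝓘(ℝ) h) :=
    hh.contMDiff_tangentMap (by simp)
  have h2 := h1.comp hX
  exact (contMDiff_snd_tangentBundle_modelSpace ℝ 𝓘(ℝ)).comp h2

theorem IsSmoothVectorField.mlieBracket [CompleteSpace E] {X Y : Π x : M, TangentSpace I x}
    (hX : IsSmoothVectorField X) (hY : IsSmoothVectorField Y) :
    IsSmoothVectorField (mlieBracket I X Y) := by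
  intro x
  have : IsManifold I (minSmoothness ℝ 2) M := by
    rw [minSmoothness_of_isRCLikeNormedField]; infer_instance
  have : IsManifold I (minSmoothness ℝ 3) M := by
    rw [minSmoothness_of_isRCLikeNormedField]; infer_instance
  have : IsManifold I ((⊤ : ℕ∞) + 1) M := by simpa using! ‹IsManifold I ∞ M›
  exact ContMDiffAt.mlieBracket_vectorField (m := ⊤) (n := ⊤) (hX x) (hY x) (by simp)

theorem mlieBracket_jacobi [CompleteSpace E] {X Y Z : Π x : M, TangentSpace I x}
    (hX : IsSmoothVectorField X) (hY : IsSmoothVectorField Y) (hZ : IsSmoothVectorField Z) :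
    mlieBracket I X (mlieBracket I Y Z) =
      mlieBracket I (mlieBracket I X Y) Z + mlieBracket I Y (mlieBracket I X Z) := by
  have : IsManifold I (minSmoothness ℝ 3) M := by
    rw [minSmoothness_of_isRCLikeNormedField]; infer_instance
  have h2 : minSmoothness ℝ 2 ≤ ∞ := by
    rw [minSmoothness_of_isRCLikeNormedField]; exact ENat.LEInfty.out
  exact leibniz_identity_mlieBracket (ContMDiff.of_le hX h2) (ContMDiff.of_le hY h2)
    (ContMDiff.of_le hZ h2)

theorem mvfderiv_commutator [FiniteDimensional ℝ E] [T2Space M] {h : M → ℝ}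
    (hh : ContMDiff I 𝓘(ℝ) ∞ h) {X Y : Π x : M, TangentSpace I x}
    (hX : IsSmoothVectorField X) (hY : IsSmoothVectorField Y) (x : M) :
    mvfderiv I h x (mlieBracket I X Y x) =
      mvfderiv I (fun y ↦ mvfderiv I h y (Y y)) x (X x)
        - mvfderiv I (fun y ↦ mvfderiv I h y (X y)) x (Y x) := by
  by_cases hT : Subsingleton (TangentSpace I x)
  · rw [Subsingleton.elim (mlieBracket I X Y x) 0, Subsingleton.elim (X x) 0,
      Subsingleton.elim (Y x) 0]
    simp
  rw [not_subsingleton_iff_nontrivial] at hT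
  obtain ⟨w, hw⟩ := exists_ne (0 : TangentSpace I x)
  set W : Π y : M, TangentSpace I y := globalExtend E I w with hWdef
  have hW : IsSmoothVectorField W := globalExtend_smooth w
  have hWx : W x = w := globalExtend_self w
  have hd : ∀ {g : M → ℝ}, ContMDiff I 𝓘(ℝ) ∞ g → ∀ y, MDiffAt g y := fun hg y ↦
    (hg.contMDiffAt).mdifferentiableAt (by simp)
  have bs : ∀ {U V : Π x : M, TangentSpace I x}, IsSmoothVectorField U → IsSmoothVectorField V →
      IsSmoothVectorField (mlieBracket I U V) := fun hU hV ↦ hU.mlieBracket hV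
  have br : ∀ {g : M → ℝ} {U V : Π x : M, TangentSpace I x}, ContMDiff I 𝓘(ℝ) ∞ g →
      IsSmoothVectorField V → mlieBracket I U (g • V) =
        (fun y ↦ mvfderiv I g y (U y)) • V + g • mlieBracket I U V := fun hg hV ↦ by
    ext y
    exact mlieBracket_smul_right (hd hg y) (hV.mdifferentiableAt y)
  have hXh := contMDiff_mvfderiv hh hX
  have hYh := contMDiff_mvfderiv hh hY
  have j1 := congrFun (mlieBracket_jacobi hX hY (hW.smul hh)) x
  have j2 := congrFun (mlieBracket_jacobi hX hY hW) x
  have radd : ∀ {U V V' : Π x : M, TangentSpace I x}, IsSmoothVectorField V →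
      IsSmoothVectorField V' →
      mlieBracket I U (V + V') = mlieBracket I U V + mlieBracket I U V' := fun hV hV' ↦ by
    ext y
    exact mlieBracket_add_right (hV.mdifferentiableAt y) (hV'.mdifferentiableAt y)
  rw [br hh hW, br hh hW, br hh hW, radd (hW.smul hYh) ((bs hY hW).smul hh),
    radd (hW.smul hXh) ((bs hX hW).smul hh), br hYh hW, br hXh hW, br hh (bs hY hW),
    br hh (bs hX hW)] at j1
  simp only [Pi.add_apply, Pi.smul_apply', hWx] at j1 j2
  rw [j2, smul_add] at j1
  have : (mvfderiv I h x (mlieBracket I X Y x) -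
      (mvfderiv I (fun y ↦ mvfderiv I h y (Y y)) x (X x)
        - mvfderiv I (fun y ↦ mvfderiv I h y (X y)) x (Y x))) • w = 0 := by
    rw [sub_smul, sub_smul]
    linear_combination (norm := module) (-1 : ℝ) • j1
  exact sub_eq_zero.mp ((smul_eq_zero.mp this).resolve_right hw)

end Functions

end SmoothFields

/-! ### Smooth connections and the Levi-Civita connection on smooth vector fields -/

section Connections

open Filter
open scoped Topology

variable {E : Type*} [NormedAddCommGroup E] [NormedSpace ℝ E]
  {H : Type*} [TopologicalSpace H] {I : ModelWithCorners ℝ E H}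
  {M : Type*} [TopologicalSpace M] [ChartedSpace H M] [IsManifold I ∞ M]

namespace CovariantDerivative

variable (D : CovariantDerivative I E (fun x : M ↦ TangentSpace I x))

/-- The vector field `D_X Y`. -/
def along (X Y : Π x : M, TangentSpace I x) : Π x : M, TangentSpace I x :=
  fun x ↦ D Y x (X x)

/-- The connection maps smooth vector fields to smooth vector fields. -/
def PreservesSmooth : Prop :=
  ∀ ⦃X Y : Π x : M, TangentSpace I x⦄, IsSmoothVectorField X → IsSmoothVectorField Y →
    IsSmoothVectorField (D.along X Y)

variable {D} {X X' Y Z : Π x : M, TangentSpace I x}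

theorem along_add_left : D.along (X + X') Y = D.along X Y + D.along X' Y := by
  ext x; simp [along]

theorem along_sub_left : D.along (X - X') Y = D.along X Y - D.along X' Y := by
  ext x; simp [along]

theorem along_const_smul_left (c : ℝ) : D.along (c • X) Y = c • D.along X Y := by
  ext x; simp [along]

theorem along_add (hY : IsSmoothVectorField Y) (hZ : IsSmoothVectorField Z) :
    D.along X (Y + Z) = D.along X Y + D.along X Z := by
  ext x
  simp [along, D.isCovariantDerivativeOnUniv.add (hY.mdifferentiableAt x) (hZ.mdifferentiableAt x)]

theorem along_smul {h : M → ℝ} (hh : ContMDiff I 𝓘(ℝ) ∞ h) (hY : IsSmoothVectorField Y) :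
    D.along X (h • Y) = h • D.along X Y + (fun x ↦ mvfderiv I h x (X x)) • Y := by
  ext x
  simp [along, D.isCovariantDerivativeOnUniv.leibniz (hY.mdifferentiableAt x)
    ((hh.contMDiffAt (x := x)).mdifferentiableAt (by simp))]

theorem along_const_smul (c : ℝ) (hY : IsSmoothVectorField Y) :
    D.along X (c • Y) = c • D.along X Y := by
  ext x
  simp [along, D.isCovariantDerivativeOnUniv.smul_const c (hY.mdifferentiableAt x)]

theorem along_neg (hY : IsSmoothVectorField Y) : D.along X (-Y) = -D.along X Y := by
  have := D.along_const_smul (X := X) (-1) hY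
  simpa using this

theorem along_sub (hY : IsSmoothVectorField Y) (hZ : IsSmoothVectorField Z) :
    D.along X (Y - Z) = D.along X Y - D.along X Z := by
  rw [sub_eq_add_neg, along_add hY hZ.neg, along_neg hZ, sub_eq_add_neg]

theorem along_zero : D.along X 0 = 0 := by
  ext x; simp [along]

theorem along_sum {ι : Type*} {s : Finset ι} {Y : ι → Π x : M, TangentSpace I x}
    (hY : ∀ i, IsSmoothVectorField (Y i)) : D.along X (∑ i ∈ s, Y i) = ∑ i ∈ s, D.along X (Y i) := by
  classical
  induction s using Finset.induction_on with
  | empty => simp [along_zero]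
  | insert a s ha ih =>
    rw [Finset.sum_insert ha, Finset.sum_insert ha, along_add (hY a) (.sum hY), ih]

theorem congr_of_eventuallyEq_smooth {x : M} (hZ : IsSmoothVectorField Z) (h : Z =ᶠ[𝓝 x] Y) :
    D Y x = D Z x := by
  have hZ' := hZ.mdifferentiableAt x
  have hY : MDiffAt (T% Y) x := hZ'.congr_of_eventuallyEq (by
    filter_upwards [h] with y hy
    rw [hy])
  exact D.isCovariantDerivativeOnUniv.congr_of_eventuallyEq hY hZ' univ_mem h.symm

variable [FiniteDimensional ℝ E] [T2Space M]

theorem curvatureAt_eq (hD : D.PreservesSmooth) {x : M} (u v w : TangentSpace I x) :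
    curvatureAt D x u v w =
      curvatureField D (globalExtend E I u) (globalExtend E I v) (globalExtend E I w) x := by
  have key : ∀ v : TangentSpace I x,
      D (fun y ↦ D (FiberBundle.extend E w : Π y : M, TangentSpace I y) y
        ((FiberBundle.extend E v : Π y : M, TangentSpace I y) y)) x =
      D (D.along (globalExtend E I v) (globalExtend E I w)) x := fun v ↦ by
    refine congr_of_eventuallyEq_smooth (hD (globalExtend_smooth v) (globalExtend_smooth w)) ?_
    filter_upwards [(globalExtend_eventuallyEq w).eventuallyEq_nhds,
      globalExtend_eventuallyEq v] with y hw hv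
    rw [along, hv, congr_of_eventuallyEq_smooth (globalExtend_smooth w) hw]
  rw [curvatureAt, curvatureField, curvatureField, key, key,
    congr_of_eventuallyEq_smooth (globalExtend_smooth w) (globalExtend_eventuallyEq w),
    (globalExtend_eventuallyEq u).symm.mlieBracket_vectorField_eq
      (globalExtend_eventuallyEq v).symm,
    ← (globalExtend_eventuallyEq u).eq_of_nhds, ← (globalExtend_eventuallyEq v).eq_of_nhds]
  rfl

end CovariantDerivative

open CovariantDerivative

variable [FiniteDimensional ℝ E]
  [RiemannianBundle (fun x : M ↦ TangentSpace I x)]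
  [IsContMDiffRiemannianBundle I ∞ E (fun x : M ↦ TangentSpace I x)]

omit [FiniteDimensional ℝ E] in
theorem IsSmoothVectorField.inner {X Y : Π x : M, TangentSpace I x} (hX : IsSmoothVectorField X)
    (hY : IsSmoothVectorField Y) : ContMDiff I 𝓘(ℝ) ∞ (fun x ↦ ⟪X x, Y x⟫_ℝ) :=
  ContMDiff.inner_bundle hX hY

namespace IsLeviCivita

variable {nabla : CovariantDerivative I E (fun x : M ↦ TangentSpace I x)} (hn : IsLeviCivita nabla)
  {X Y Z W : Π x : M, TangentSpace I x}
include hn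

theorem preservesSmooth : nabla.PreservesSmooth := fun X Y hX hY ↦ by
  have h1 : ContMDiff I I.tangent (∞ + 1) (T% Y) := by
    simpa [IsSmoothVectorField] using hY
  have h2 := hn.smooth.contMDiff.contMDiff h1.contMDiffOn
  exact ContMDiff.clm_bundle_apply (contMDiffOn_univ.mp h2) hX

theorem mlieBracket_eq (hX : IsSmoothVectorField X) (hY : IsSmoothVectorField Y) :
    mlieBracket I X Y = nabla.along X Y - nabla.along Y X := by
  ext x
  exact ((nabla.torsion_eq_zero_iff.mp hn.symmetric) (hX.mdifferentiableAt x)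
    (hY.mdifferentiableAt x)).symm

theorem mvfderiv_inner (hY : IsSmoothVectorField Y) (hZ : IsSmoothVectorField Z) (x : M)
    (v : TangentSpace I x) :
    mvfderiv I (fun y ↦ ⟪Y y, Z y⟫_ℝ) x v = ⟪nabla Y x v, Z x⟫_ℝ + ⟪Y x, nabla Z x v⟫_ℝ := by
  have := hn.metric.mvfderiv_inner_eq (FiberBundle.extend E v) (hY.mdifferentiableAt x)
    (hZ.mdifferentiableAt x)
  simpa using this

theorem mvfderiv_inner_along (hY : IsSmoothVectorField Y) (hZ : IsSmoothVectorField Z) :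
    (fun x ↦ mvfderiv I (fun y ↦ ⟪Y y, Z y⟫_ℝ) x (X x)) =
      fun x ↦ ⟪nabla.along X Y x, Z x⟫_ℝ + ⟪Y x, nabla.along X Z x⟫_ℝ :=
  funext fun x ↦ hn.mvfderiv_inner hY hZ x (X x)

theorem curvatureField_eq (hX : IsSmoothVectorField X) (hY : IsSmoothVectorField Y) :
    curvatureField nabla X Y Z = nabla.along X (nabla.along Y Z) - nabla.along Y (nabla.along X Z)
      - nabla.along (nabla.along X Y) Z + nabla.along (nabla.along Y X) Z := by
  have : curvatureField nabla X Y Z = nabla.along X (nabla.along Y Z)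
      - nabla.along Y (nabla.along X Z) - nabla.along (mlieBracket I X Y) Z := rfl
  rw [this, hn.mlieBracket_eq hX hY, along_sub_left]
  abel

theorem curvatureField_swap (hX : IsSmoothVectorField X) (hY : IsSmoothVectorField Y) :
    curvatureField nabla X Y Z = -curvatureField nabla Y X Z := by
  rw [hn.curvatureField_eq hX hY, hn.curvatureField_eq hY hX]
  abel

theorem bianchi (hX : IsSmoothVectorField X) (hY : IsSmoothVectorField Y)
    (hZ : IsSmoothVectorField Z) :
    curvatureField nabla X Y Z + curvatureField nabla Y Z X + curvatureField nabla Z X Y = 0 := by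
  have hs := hn.preservesSmooth
  have h := mlieBracket_jacobi hX hY hZ
  have hb : ∀ {U V : Π x : M, TangentSpace I x}, IsSmoothVectorField U → IsSmoothVectorField V →
    IsSmoothVectorField (nabla.along U V - nabla.along V U) := fun hU hV ↦
      (hs hU hV).sub (hs hV hU)
  rw [hn.mlieBracket_eq hY hZ, hn.mlieBracket_eq hX hY, hn.mlieBracket_eq hX hZ,
    hn.mlieBracket_eq hX (hb hY hZ), hn.mlieBracket_eq (hb hX hY) hZ,
    hn.mlieBracket_eq hY (hb hX hZ), along_sub (hs hY hZ) (hs hZ hY),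
    along_sub (hs hX hY) (hs hY hX), along_sub (hs hX hZ) (hs hZ hX), along_sub_left,
    along_sub_left, along_sub_left] at h
  rw [hn.curvatureField_eq hX hY, hn.curvatureField_eq hY hZ, hn.curvatureField_eq hZ hX]
  rw [← sub_eq_zero] at h
  rw [← h]
  abel

theorem inner_curvatureField_swap [T2Space M] (hX : IsSmoothVectorField X)
    (hY : IsSmoothVectorField Y) (hZ : IsSmoothVectorField Z) (hW : IsSmoothVectorField W) (x : M) :
    ⟪curvatureField nabla X Y Z x, W x⟫_ℝ = -⟪Z x, curvatureField nabla X Y W x⟫_ℝ := by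
  have hs := hn.preservesSmooth
  have hc := mvfderiv_commutator (hZ.inner hW) hX hY x
  have hadd : ∀ {U V : Π x : M, TangentSpace I x}, IsSmoothVectorField U → IsSmoothVectorField V →
      mvfderiv I (fun y ↦ mvfderiv I (fun y ↦ ⟪Z y, W y⟫_ℝ) y (V y)) x (U x) =
      ⟪nabla.along U (nabla.along V Z) x, W x⟫_ℝ + ⟪nabla.along V Z x, nabla.along U W x⟫_ℝ
      + (⟪nabla.along U Z x, nabla.along V W x⟫_ℝ + ⟪Z x, nabla.along U (nabla.along V W) x⟫_ℝ) := by
    intro U V hU hV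
    rw [hn.mvfderiv_inner_along hZ hW, mvfderiv_fun_add, add_apply,
      hn.mvfderiv_inner (hs hV hZ) hW, hn.mvfderiv_inner hZ (hs hV hW)]
    · rfl
    · exact (((hs hV hZ).inner hW).contMDiffAt).mdifferentiableAt (by simp)
    · exact ((hZ.inner (hs hV hW)).contMDiffAt).mdifferentiableAt (by simp)
  rw [hadd hX hY, hadd hY hX, hn.mvfderiv_inner hZ hW] at hc
  have e : ∀ U, curvatureField nabla X Y U x = nabla.along X (nabla.along Y U) x
      - nabla.along Y (nabla.along X U) x - nabla U x (mlieBracket I X Y x) := fun _ ↦ rfl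
  rw [e, e, inner_sub_left, inner_sub_left, inner_sub_right, inner_sub_right]
  linarith

end IsLeviCivita

end Connections

section CurvatureForm

open CovariantDerivative

variable {E : Type*} [NormedAddCommGroup E] [NormedSpace ℝ E] [FiniteDimensional ℝ E]
  {H : Type*} [TopologicalSpace H] {I : ModelWithCorners ℝ E H}
  {M : Type*} [TopologicalSpace M] [ChartedSpace H M] [IsManifold I ∞ M] [T2Space M]
  [RiemannianBundle (fun x : M ↦ TangentSpace I x)]

/-- A skew-symmetric operation on vector fields is tensorial. -/
theorem exists_linearMap_of_skew {x : M} (Φ : (Π y : M, TangentSpace I y) → TangentSpace I x)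
    (hΦ : ∀ Y Z, IsSmoothVectorField Y → IsSmoothVectorField Z →
      ⟪Φ Y, Z x⟫_ℝ = -⟪Y x, Φ Z⟫_ℝ) :
    ∃ L : TangentSpace I x →ₗ[ℝ] TangentSpace I x, ∀ Y, IsSmoothVectorField Y → Φ Y = L (Y x) := by
  have key : ∀ Y, IsSmoothVectorField Y → ∀ z : TangentSpace I x,
      ⟪Φ Y, z⟫_ℝ = -⟪Y x, Φ (globalExtend E I z)⟫_ℝ := fun Y hY z ↦ by
    simpa using hΦ Y (globalExtend E I z) hY (globalExtend_smooth z)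
  refine ⟨{ toFun := fun v ↦ Φ (globalExtend E I v), map_add' := fun v w ↦ ?_,
            map_smul' := fun c v ↦ ?_ }, fun Y hY ↦ ?_⟩
  · refine ext_inner_right ℝ fun z ↦ ?_
    rw [inner_add_left, key _ (globalExtend_smooth _), key _ (globalExtend_smooth _),
      key _ (globalExtend_smooth _)]
    simp only [globalExtend_self, inner_add_left]
    ring
  · refine ext_inner_right ℝ fun z ↦ ?_
    rw [RingHom.id_apply, real_inner_smul_left, key _ (globalExtend_smooth _),
      key _ (globalExtend_smooth _)]
    simp only [globalExtend_self, real_inner_smul_left]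
    ring
  · refine ext_inner_right ℝ fun z ↦ ?_
    rw [key Y hY, LinearMap.coe_mk, AddHom.coe_mk, key _ (globalExtend_smooth _),
      globalExtend_self]

variable [IsContMDiffRiemannianBundle I ∞ E (fun x : M ↦ TangentSpace I x)]

namespace IsLeviCivita

variable {nabla : CovariantDerivative I E (fun x : M ↦ TangentSpace I x)} (hn : IsLeviCivita nabla)
  {X X' Y Z W : Π x : M, TangentSpace I x}
include hn

omit [T2Space M] in
theorem curvatureField_add_left (hX : IsSmoothVectorField X) (hX' : IsSmoothVectorField X')
    (hY : IsSmoothVectorField Y) (hZ : IsSmoothVectorField Z) :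
    curvatureField nabla (X + X') Y Z = curvatureField nabla X Y Z + curvatureField nabla X' Y Z := by
  have hs := hn.preservesSmooth
  rw [hn.curvatureField_eq (hX.add hX') hY, hn.curvatureField_eq hX hY,
    hn.curvatureField_eq hX' hY, along_add_left, along_add_left, along_add_left, along_add_left,
    along_add hX hX', along_add (hs hX hZ) (hs hX' hZ), along_add_left]
  abel

omit [T2Space M] in
theorem curvatureField_smul_left (c : ℝ) (hX : IsSmoothVectorField X)
    (hY : IsSmoothVectorField Y) (hZ : IsSmoothVectorField Z) :
    curvatureField nabla (c • X) Y Z = c • curvatureField nabla X Y Z := by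
  have hs := hn.preservesSmooth
  have hcX : IsSmoothVectorField (c • X) := ContMDiff.const_smul_section hX
  rw [hn.curvatureField_eq hcX hY, hn.curvatureField_eq hX hY, along_const_smul_left,
    along_const_smul_left, along_const_smul_left, along_const_smul c hX,
    along_const_smul c (hs hX hZ), along_const_smul_left]
  rw [along_const_smul_left, smul_add, smul_sub, smul_sub]

/-- The curvature tensor of the Levi-Civita connection at a point as a `4`-linear form. -/
theorem exists_curvatureForm (x : M) :
    ∃ T : TangentSpace I x →ₗ[ℝ] TangentSpace I x →ₗ[ℝ] TangentSpace I x →ₗ[ℝ]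
        TangentSpace I x →ₗ[ℝ] ℝ, IsAlgebraicCurvature T ∧
      ∀ u v w : TangentSpace I x, ∀ Z, IsSmoothVectorField Z → T u v (Z x) w =
        ⟪curvatureField nabla (globalExtend E I u) (globalExtend E I v) Z x, w⟫_ℝ := by
  have hG : ∀ v : TangentSpace I x, IsSmoothVectorField (globalExtend E I v) := globalExtend_smooth
  have hex : ∀ u v : TangentSpace I x, ∃ L : TangentSpace I x →ₗ[ℝ] TangentSpace I x,
      ∀ Z, IsSmoothVectorField Z →
        curvatureField nabla (globalExtend E I u) (globalExtend E I v) Z x = L (Z x) := fun u v ↦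
    exists_linearMap_of_skew _ fun Z W hZ hW ↦
      hn.inner_curvatureField_swap (hG u) (hG v) hZ hW x
  choose L hL using hex
  have hL' : ∀ u v w, L u v w = curvatureField nabla (globalExtend E I u) (globalExtend E I v)
      (globalExtend E I w) x := fun u v w ↦ by
    rw [hL u v _ (hG w), globalExtend_self]
  have hswap : ∀ u v, L u v = -L v u := fun u v ↦ by
    ext1 w
    rw [LinearMap.neg_apply, hL', hL', hn.curvatureField_swap (hG u) (hG v)]
    rfl
  have hadd : ∀ u u' v, L (u + u') v = L u v + L u' v := fun u u' v ↦ by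
    ext1 w
    rw [LinearMap.add_apply, hL', hL', hL', globalExtend_add,
      hn.curvatureField_add_left (hG u) (hG u') (hG v) (hG w)]
    rfl
  have hsmul : ∀ (c : ℝ) u v, L (c • u) v = c • L u v := fun c u v ↦ by
    ext1 w
    rw [LinearMap.smul_apply, hL', hL', globalExtend_smul,
      hn.curvatureField_smul_left c (hG u) (hG v) (hG w)]
    rfl
  let R := LinearMap.mk₂ ℝ L hadd hsmul
    (fun u v v' ↦ by rw [hswap, hadd, hswap u v, hswap u v']; abel)
    (fun c u v ↦ by rw [hswap, hsmul, hswap u v, smul_neg])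
  let T := R.compr₂ (LinearMap.llcomp ℝ (TangentSpace I x) (TangentSpace I x)
    (TangentSpace I x →ₗ[ℝ] ℝ) (innerₗ (TangentSpace I x)))
  have hT : ∀ u v w z, T u v w z = ⟪L u v w, z⟫_ℝ := fun u v w z ↦ rfl
  refine ⟨T, ⟨fun u v w z ↦ ?_, fun u v w z ↦ ?_, fun u v w z ↦ ?_⟩, fun u v w Z hZ ↦ ?_⟩
  · rw [hT, hT, hswap, LinearMap.neg_apply, inner_neg_left]
  · have := hn.inner_curvatureField_swap (hG u) (hG v) (hG w) (hG z) x
    rw [hT, hT, hL', hL', real_inner_comm]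
    simpa [real_inner_comm] using this
  · have := congrFun (hn.bianchi (hG u) (hG v) (hG w)) x
    rw [hT, hT, hT, hL', hL', hL', ← inner_add_left, ← inner_add_left]
    have h0 : ⟪(0 : TangentSpace I x), z⟫_ℝ = 0 := inner_zero_left z
    rw [← h0]
    congr 1
  · rw [hT, hL u v Z hZ]

end IsLeviCivita

end CurvatureForm

/-! ### First covariant derivatives of the tensors of an `S`-structure -/

section SStructure

open CovariantDerivative

variable {E : Type*} [NormedAddCommGroup E] [NormedSpace ℝ E]
  {H : Type*} [TopologicalSpace H] {I : ModelWithCorners ℝ E H}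
  {M : Type*} [TopologicalSpace M] [ChartedSpace H M] [IsManifold I ∞ M]
  [RiemannianBundle (fun x : M ↦ TangentSpace I x)] {s : ℕ}

namespace MetricFStructure

variable (S : MetricFStructure I M s)

theorem eta_eq (x : M) (α : Fin s) (v : TangentSpace I x) : S.eta α x v = ⟪v, S.xi α x⟫_ℝ := by
  have h := S.inner_f_f x v (S.xi α x)
  rw [S.f_xi, inner_zero_right] at h
  simp only [S.eta_xi, mul_ite, mul_one, mul_zero, Finset.sum_ite_eq', Finset.mem_univ,
    if_true] at h
  linarith

theorem isLinearFStructure (x : M) :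
    IsLinearFStructure (S.f x : TangentSpace I x →ₗ[ℝ] TangentSpace I x) (fun α ↦ S.xi α x) where
  f_f v := by
    simp only [ContinuousLinearMap.coe_coe, S.f_f, S.eta_eq]
  f_xi α := S.f_xi x α
  xi_xi α β := by
    rw [← S.eta_eq, S.eta_xi]
    simp only [eq_comm]
  skew v w := by
    have hfx : ∀ v α, ⟪S.f x v, S.xi α x⟫_ℝ = 0 := fun v α ↦ by rw [← S.eta_eq, S.eta_f]
    have h := S.inner_f_f x v (S.f x w)
    simp only [S.eta_f, mul_zero, Finset.sum_const_zero, sub_zero, S.f_f, inner_add_right,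
      inner_neg_right, inner_sum, real_inner_smul_right, hfx, add_zero] at h
    simp only [ContinuousLinearMap.coe_coe]
    rw [← h, neg_neg]

/-- The vector field `fX`. -/
def fField (X : Π x : M, TangentSpace I x) : Π x : M, TangentSpace I x :=
  fun x ↦ S.f x (X x)

/-- The sum of the structure vector fields. -/
def sumXi : Π x : M, TangentSpace I x :=
  ∑ α, S.xi α

theorem sumXi_apply (x : M) : S.sumXi x = ∑ α, S.xi α x := by
  simp [sumXi]

theorem fField_apply (X : Π x : M, TangentSpace I x) (x : M) : S.fField X x = S.f x (X x) := rfl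

theorem fField_smooth {X : Π x : M, TangentSpace I x} (hX : IsSmoothVectorField X) :
    IsSmoothVectorField (S.fField X) :=
  ContMDiff.clm_bundle_apply S.smooth_f hX

theorem sumXi_smooth : IsSmoothVectorField S.sumXi :=
  IsSmoothVectorField.sum S.smooth_xi

theorem fField_fField (X : Π x : M, TangentSpace I x) :
    S.fField (S.fField X) = -X + ∑ α, (fun x ↦ ⟪X x, S.xi α x⟫_ℝ) • S.xi α := by
  ext x
  simp [fField_apply, S.f_f, S.eta_eq]

theorem fField_xi (α : Fin s) : S.fField (S.xi α) = 0 := by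
  ext x
  exact S.f_xi x α

section LeviCivita

variable [FiniteDimensional ℝ E] [T2Space M]
  [IsContMDiffRiemannianBundle I ∞ E (fun x : M ↦ TangentSpace I x)]
  {S}
  {nabla : CovariantDerivative I E (fun x : M ↦ TangentSpace I x)} (hn : IsLeviCivita nabla)
  {X Y Z : Π x : M, TangentSpace I x}
include hn

omit [T2Space M] in
theorem inner_nabla_f_skew (x : M) (u : TangentSpace I x) (hY : IsSmoothVectorField Y)
    (hZ : IsSmoothVectorField Z) :
    ⟪nabla (S.fField Y) x u - S.f x (nabla Y x u), Z x⟫_ℝ =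
      -⟪Y x, nabla (S.fField Z) x u - S.f x (nabla Z x u)⟫_ℝ := by
  have hskew : ∀ (x : M) (v w : TangentSpace I x), ⟪S.f x v, w⟫_ℝ = -⟪v, S.f x w⟫_ℝ :=
    fun x ↦ (S.isLinearFStructure x).skew
  have h1 := hn.mvfderiv_inner (S.fField_smooth hY) hZ x u
  have h2 := hn.mvfderiv_inner hY (S.fField_smooth hZ) x u
  have h3 : (fun y ↦ ⟪S.fField Y y, Z y⟫_ℝ) = fun y ↦ -⟪Y y, S.fField Z y⟫_ℝ :=
    funext fun y ↦ hskew y _ _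
  rw [h3, mvfderiv_fun_neg, neg_apply, h2] at h1
  rw [inner_sub_left, inner_sub_right, hskew, ← neg_eq_iff_eq_neg.mpr (hskew x (Y x) (nabla Z x u))]
  simp only [fField_apply] at h1 ⊢
  linarith

/-- The tensor `(∇_X f) Y` at a point. -/
theorem exists_nabla_f (S : MetricFStructure I M s) (x : M) :
    ∃ A : TangentSpace I x →ₗ[ℝ] TangentSpace I x →ₗ[ℝ] TangentSpace I x,
      ∀ u, ∀ Y, IsSmoothVectorField Y →
        nabla (S.fField Y) x u - S.f x (nabla Y x u) = A u (Y x) := by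
  have hex := fun u : TangentSpace I x ↦
    exists_linearMap_of_skew (fun Y ↦ nabla (S.fField Y) x u - S.f x (nabla Y x u))
      fun Y Z hY hZ ↦ inner_nabla_f_skew (S := S) hn x u hY hZ
  choose L hL using hex
  have hL' : ∀ u v, L u v = nabla (S.fField (globalExtend E I v)) x u
      - S.f x (nabla (globalExtend E I v) x u) := fun u v ↦ by
    rw [hL u _ (globalExtend_smooth v), globalExtend_self]
  refine ⟨{ toFun := L, map_add' := fun u u' ↦ ?_, map_smul' := fun c u ↦ ?_ },
    fun u Y hY ↦ hL u Y hY⟩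
  · ext1 v
    rw [LinearMap.add_apply, hL', hL', hL']
    simp only [map_add]
    abel
  · ext1 v
    rw [RingHom.id_apply, LinearMap.smul_apply, hL', hL']
    simp only [map_smul, smul_sub]

omit [T2Space M] in
theorem dOneForm_eq (S : MetricFStructure I M s) (α : Fin s) (hX : IsSmoothVectorField X)
    (hY : IsSmoothVectorField Y) (x : M) :
    2 * dOneForm (S.eta α) X Y x =
      ⟪nabla (S.xi α) x (X x), Y x⟫_ℝ - ⟪nabla (S.xi α) x (Y x), X x⟫_ℝ := by
  have h1 : ∀ Z : Π x : M, TangentSpace I x,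
      (fun y ↦ S.eta α y (Z y)) = fun y ↦ ⟪Z y, S.xi α y⟫_ℝ := fun Z ↦ funext fun y ↦ S.eta_eq y α _
  rw [dOneForm, h1, h1, hn.mvfderiv_inner hY (S.smooth_xi α), hn.mvfderiv_inner hX (S.smooth_xi α),
    S.eta_eq, hn.mlieBracket_eq hX hY, Pi.sub_apply, inner_sub_left, along, along,
    real_inner_comm (Y x) (nabla (S.xi α) x (X x)), real_inner_comm (X x)]
  ring

variable (hS : S.IsSStructure)
include hS

theorem inner_nabla_xi_sub (x : M) (u v : TangentSpace I x) (α : Fin s) :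
    ⟪nabla (S.xi α) x u, v⟫_ℝ - ⟪nabla (S.xi α) x v, u⟫_ℝ = 2 * ⟪u, S.f x v⟫_ℝ := by
  have h1 := dOneForm_eq hn S α (globalExtend_smooth u) (globalExtend_smooth v) x
  rw [← hS.d_eta α _ _ (globalExtend_smooth u) (globalExtend_smooth v) x, fundamentalForm] at h1
  simpa using h1.symm

/-- `dη = Φ` differentiated once. -/
theorem inner_nabla_nabla_xi_sub (α : Fin s) (hX : IsSmoothVectorField X)
    (hY : IsSmoothVectorField Y) (x : M) :
    ⟪nabla.along Z (nabla.along X (S.xi α)) x - nabla.along (nabla.along Z X) (S.xi α) x, Y x⟫_ℝ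
      - ⟪nabla.along Z (nabla.along Y (S.xi α)) x - nabla.along (nabla.along Z Y) (S.xi α) x,
        X x⟫_ℝ =
    2 * ⟪X x, nabla (S.fField Y) x (Z x) - S.f x (nabla Y x (Z x))⟫_ℝ := by
  have hs := hn.preservesSmooth
  have hxi := S.smooth_xi α
  have hd : ∀ {g : M → ℝ}, ContMDiff I (modelWithCornersSelf ℝ ℝ) ∞ g → MDiffAt g x := fun hg ↦
    (hg.contMDiffAt).mdifferentiableAt (by simp)
  have h1 : (fun y ↦ ⟪nabla.along X (S.xi α) y, Y y⟫_ℝ - ⟪nabla.along Y (S.xi α) y, X y⟫_ℝ) =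
      fun y ↦ 2 * ⟪X y, S.fField Y y⟫_ℝ := funext fun y ↦ inner_nabla_xi_sub hn hS y _ _ α
  have h2 := congrArg (fun g ↦ mvfderiv I g x (Z x)) h1
  rw [mvfderiv_fun_sub (hd ((hs hX hxi).inner hY)) (hd ((hs hY hxi).inner hX)), sub_apply,
    hn.mvfderiv_inner (hs hX hxi) hY, hn.mvfderiv_inner (hs hY hxi) hX,
    mvfderiv_fun_mul (hd contMDiff_const) (hd (hX.inner (S.fField_smooth hY)))] at h2
  simp only [mvfderiv_const, smul_apply, hn.mvfderiv_inner hX (S.fField_smooth hY),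
    smul_zero, add_zero, smul_eq_mul] at h2
  have h3 := inner_nabla_xi_sub hn hS x (nabla X x (Z x)) (Y x) α
  have h4 := inner_nabla_xi_sub hn hS x (X x) (nabla Y x (Z x)) α
  simp only [along, inner_sub_left, inner_sub_right, fField_apply] at *
  linarith

theorem isFirstOrderSStructure (hs1 : 1 ≤ s) {x : M}
    {A : TangentSpace I x →ₗ[ℝ] TangentSpace I x →ₗ[ℝ] TangentSpace I x}
    (hA : ∀ u, ∀ Y, IsSmoothVectorField Y →
        nabla (S.fField Y) x u - S.f x (nabla Y x u) = A u (Y x)) :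
    IsFirstOrderSStructure (S.f x : TangentSpace I x →ₗ[ℝ] TangentSpace I x) (fun α ↦ S.xi α x) A
      (fun α ↦ (nabla (S.xi α) x : TangentSpace I x →ₗ[ℝ] TangentSpace I x)) where
  toIsLinearFStructure := S.isLinearFStructure x
  A_skew u v w := by
    have := inner_nabla_f_skew (S := S) hn x u (globalExtend_smooth v) (globalExtend_smooth w)
    rw [hA u _ (globalExtend_smooth v), hA u _ (globalExtend_smooth w)] at this
    simpa using this
  A_f u v := by
    have hG : IsSmoothVectorField (globalExtend E I v) := globalExtend_smooth v
    have h1 := hA u _ (S.fField_smooth hG)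
    have h2 := hA u _ hG
    have hin := fun α ↦ hG.inner (S.smooth_xi α)
    have h3 : nabla (S.fField (S.fField (globalExtend E I v))) x u =
        -nabla (globalExtend E I v) x u + ∑ α, (⟪v, S.xi α x⟫_ℝ • nabla (S.xi α) x u
          + (⟪nabla (globalExtend E I v) x u, S.xi α x⟫_ℝ
            + ⟪v, nabla (S.xi α) x u⟫_ℝ) • S.xi α x) := by
      have h4 := congrFun (congrArg (nabla.along (globalExtend E I u))
        (S.fField_fField (globalExtend E I v))) x
      rw [along_add hG.neg (.sum fun α ↦ (S.smooth_xi α).smul (hin α)), along_neg hG,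
        along_sum fun α ↦ (S.smooth_xi α).smul (hin α)] at h4
      simp only [fun α ↦ along_smul (D := nabla) (X := globalExtend E I u) (hin α) (S.smooth_xi α),
        Pi.add_apply, Pi.neg_apply, Finset.sum_apply, Pi.smul_apply', along, globalExtend_self,
        hn.mvfderiv_inner hG (S.smooth_xi _)] at h4
      exact h4
    simp only [fField_apply, globalExtend_self] at h1 h2
    simp only [ContinuousLinearMap.coe_coe, ← h1, ← h2, map_sub, S.f_f, S.eta_eq, h3, add_smul,
      Finset.sum_add_distrib, real_inner_comm v]
    abel
  A_xi u α := by
    have h1 := hA u _ (S.smooth_xi α)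
    rw [fField_xi, nabla.zero] at h1
    simpa using h1.symm
  N_xi u α β := by
    have h1 := hn.mvfderiv_inner (S.smooth_xi α) (S.smooth_xi β) x u
    have h2 : (fun y ↦ ⟪S.xi α y, S.xi β y⟫_ℝ) = fun _ ↦ if α = β then (1 : ℝ) else 0 :=
      funext fun y ↦ (S.isLinearFStructure y).xi_xi α β
    rw [h2, mvfderiv_const, real_inner_comm (nabla (S.xi β) x u)] at h1
    simp only [ContinuousLinearMap.coe_coe]
    have h3 : (0 : TangentSpace I x →L[ℝ] ℝ) u = 0 := rfl
    linarith
  normal u v := by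
    have hU : IsSmoothVectorField (globalExtend E I u) := globalExtend_smooth u
    have hV : IsSmoothVectorField (globalExtend E I v) := globalExtend_smooth v
    have h1 := hS.normal _ _ hU hV x
    simp only [← hS.d_eta _ _ _ hU hV, fundamentalForm, globalExtend_self] at h1
    have h2 : nijenhuis S.f (globalExtend E I u) (globalExtend E I v) x =
        S.f x (S.f x (mlieBracket I (globalExtend E I u) (globalExtend E I v) x))
        + mlieBracket I (S.fField (globalExtend E I u)) (S.fField (globalExtend E I v)) x
        - S.f x (mlieBracket I (S.fField (globalExtend E I u)) (globalExtend E I v) x)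
        - S.f x (mlieBracket I (globalExtend E I u) (S.fField (globalExtend E I v)) x) := rfl
    rw [h2, hn.mlieBracket_eq hU hV, hn.mlieBracket_eq (S.fField_smooth hU) (S.fField_smooth hV),
      hn.mlieBracket_eq (S.fField_smooth hU) hV, hn.mlieBracket_eq hU (S.fField_smooth hV)] at h1
    have hAv : ∀ z, nabla (S.fField (globalExtend E I v)) x z
        - S.f x (nabla (globalExtend E I v) x z) = A z v := fun z ↦ by
      rw [hA z _ hV, globalExtend_self]
    have hAu : ∀ z, nabla (S.fField (globalExtend E I u)) x z
        - S.f x (nabla (globalExtend E I u) x z) = A z u := fun z ↦ by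
      rw [hA z _ hU, globalExtend_self]
    simp only [ContinuousLinearMap.coe_coe, ← hAv, ← hAu]
    simp only [Pi.sub_apply, along, fField_apply, globalExtend_self, map_sub] at h1 ⊢
    rw [← h1]
    abel
  d_eta u v α := inner_nabla_xi_sub hn hS x u v α
  d_fundamental u v w := by
    have hs := hn.preservesSmooth
    have hU : IsSmoothVectorField (globalExtend E I u) := globalExtend_smooth u
    have hV : IsSmoothVectorField (globalExtend E I v) := globalExtend_smooth v
    have hW : IsSmoothVectorField (globalExtend E I w) := globalExtend_smooth w
    let α : Fin s := ⟨0, hs1⟩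
    have hxi := S.smooth_xi α
    have e1 := inner_nabla_nabla_xi_sub hn hS α hW hV x (Z := globalExtend E I u)
    have e2 := inner_nabla_nabla_xi_sub hn hS α hU hW x (Z := globalExtend E I v)
    have e3 := inner_nabla_nabla_xi_sub hn hS α hV hU x (Z := globalExtend E I w)
    rw [hA _ _ hV] at e1
    rw [hA _ _ hW] at e2
    rw [hA _ _ hU] at e3
    have r1 := hn.inner_curvatureField_swap hU hV hxi hW x
    have r2 := hn.inner_curvatureField_swap hV hW hxi hU x
    have r3 := hn.inner_curvatureField_swap hW hU hxi hV x
    have b := congrArg (fun z ↦ ⟪S.xi α x, z⟫_ℝ) (congrFun (hn.bianchi hU hV hW) x)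
    simp only [Pi.add_apply, inner_add_right, Pi.zero_apply, inner_zero_right] at b
    rw [hn.curvatureField_eq hU hV (Z := S.xi α)] at r1
    rw [hn.curvatureField_eq hV hW (Z := S.xi α)] at r2
    rw [hn.curvatureField_eq hW hU (Z := S.xi α)] at r3
    simp only [Pi.add_apply, Pi.sub_apply, inner_add_left, inner_sub_left, globalExtend_self]
      at e1 e2 e3 r1 r2 r3
    rw [real_inner_comm w, real_inner_comm u, real_inner_comm v]
    linarith

end LeviCivita

end MetricFStructure

end SStructure

/-! ### Curvature of an `S`-structure and of its semi-symmetric metric connection -/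

section SCurvature

open CovariantDerivative

variable {E : Type*} [NormedAddCommGroup E] [NormedSpace ℝ E]
  {H : Type*} [TopologicalSpace H] {I : ModelWithCorners ℝ E H}
  {M : Type*} [TopologicalSpace M] [ChartedSpace H M] [IsManifold I ∞ M]
  [RiemannianBundle (fun x : M ↦ TangentSpace I x)] {s : ℕ}

namespace MetricFStructure

theorem semiSymmetric_along (S : MetricFStructure I M s)
    (nabla : CovariantDerivative I E (fun x : M ↦ TangentSpace I x))
    (X Y : Π x : M, TangentSpace I x) :
     (S.semiSymmetric nabla).along X Y = nabla.along X Y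
    + (fun x ↦ ⟪Y x, S.sumXi x⟫_ℝ) • X - (fun x ↦ ⟪X x, Y x⟫_ℝ) • S.sumXi := by
  ext x
  simp [along, semiSymmetric_apply, sumXi_apply, eta_eq, inner_sum, Finset.sum_smul,
    Finset.smul_sum]

variable [FiniteDimensional ℝ E] [T2Space M]
  [IsContMDiffRiemannianBundle I ∞ E (fun x : M ↦ TangentSpace I x)]
  {S : MetricFStructure I M s}
  {nabla : CovariantDerivative I E (fun x : M ↦ TangentSpace I x)} (hn : IsLeviCivita nabla)
  (hS : S.IsSStructure) (hs1 : 1 ≤ s) {X Y Z : Π x : M, TangentSpace I x}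
include hn hS hs1

theorem nabla_xi (α : Fin s) (x : M) (u : TangentSpace I x) :
    nabla (S.xi α) x u = -S.f x u := by
  obtain ⟨A, hA⟩ := exists_nabla_f hn S x
  exact (isFirstOrderSStructure hn hS hs1 hA).N_eq α u

theorem along_xi (α : Fin s) : nabla.along X (S.xi α) = -S.fField X :=
  funext fun x ↦ nabla_xi hn hS hs1 α x (X x)

theorem along_sumXi : nabla.along X S.sumXi = -((s : ℝ) • S.fField X) := by
  rw [sumXi, along_sum S.smooth_xi]
  simp only [along_xi hn hS hs1]
  simp [← Nat.cast_smul_eq_nsmul ℝ]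

theorem along_fField (hY : IsSmoothVectorField Y) :
    nabla.along X (S.fField Y) = S.fField (nabla.along X Y)
      + (fun x ↦ ⟪S.fField X x, S.fField Y x⟫_ℝ) • S.sumXi
      + (fun x ↦ ⟪Y x, S.sumXi x⟫_ℝ) • S.fField (S.fField X) := by
  ext x
  obtain ⟨A, hA⟩ := exists_nabla_f hn S x
  have h1 := hA (X x) Y hY
  rw [(isFirstOrderSStructure hn hS hs1 hA).A_eq, sub_eq_iff_eq_add] at h1
  simp only [along, Pi.add_apply, Pi.smul_apply', h1, fField_apply, sumXi_apply,
    ContinuousLinearMap.coe_coe]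
  abel

theorem mvfderiv_inner_sumXi (hY : IsSmoothVectorField Y) (x : M) :
    mvfderiv I (fun y ↦ ⟪Y y, S.sumXi y⟫_ℝ) x (X x) =
      ⟪nabla.along X Y x, S.sumXi x⟫_ℝ - s * ⟪Y x, S.f x (X x)⟫_ℝ := by
  have h1 := congrFun (along_sumXi (X := X) hn hS hs1) x
  have h2 : nabla S.sumXi x (X x) = _ := h1
  rw [hn.mvfderiv_inner hY S.sumXi_smooth, h2]
  simp only [Pi.neg_apply, Pi.smul_apply, inner_neg_right, real_inner_smul_right, along,
    fField_apply]
  ring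

/-- The second covariant derivative of `fZ`, paired with a vector of `𝓛`. -/
theorem inner_along_along_fField (hY : IsSmoothVectorField Y)
    (hZ : IsSmoothVectorField Z) {x : M} {w : TangentSpace I x} (hZx : ⟪Z x, S.sumXi x⟫_ℝ = 0)
    (hw : ⟪S.sumXi x, w⟫_ℝ = 0) :
    ⟪nabla.along X (nabla.along Y (S.fField Z)) x, w⟫_ℝ =
      ⟪S.f x (nabla.along X (nabla.along Y Z) x), w⟫_ℝ
      + ⟪nabla.along Y Z x, S.sumXi x⟫_ℝ * ⟪S.f x (S.f x (X x)), w⟫_ℝ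
      - s * ⟪S.f x (Y x), S.f x (Z x)⟫_ℝ * ⟪S.f x (X x), w⟫_ℝ
      + (⟪nabla.along X Z x, S.sumXi x⟫_ℝ - s * ⟪Z x, S.f x (X x)⟫_ℝ)
        * ⟪S.f x (S.f x (Y x)), w⟫_ℝ := by
  have hs := hn.preservesSmooth
  have hP := S.sumXi_smooth
  have h1 := (S.fField_smooth hY).inner (S.fField_smooth hZ)
  have h2 := hZ.inner hP
  have hYY := S.fField_smooth (S.fField_smooth hY)
  rw [along_fField hn hS hs1 hZ, along_add ((S.fField_smooth (hs hY hZ)).add (hP.smul h1))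
    (hYY.smul h2), along_add (S.fField_smooth (hs hY hZ)) (hP.smul h1), along_smul h1 hP,
    along_smul h2 hYY, along_fField hn hS hs1 (hs hY hZ), along_sumXi hn hS hs1]
  simp only [Pi.add_apply, Pi.smul_apply', Pi.neg_apply, Pi.smul_apply, inner_add_left,
    inner_neg_left, real_inner_smul_left, mvfderiv_inner_sumXi hn hS hs1 hZ, hZx, hw, fField_apply]
  ring

theorem isSCurvature {x : M}
    {T : TangentSpace I x →ₗ[ℝ] TangentSpace I x →ₗ[ℝ] TangentSpace I x →ₗ[ℝ]
        TangentSpace I x →ₗ[ℝ] ℝ} (hT : IsAlgebraicCurvature T)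
    (hTR : ∀ u v w : TangentSpace I x, ∀ Z, IsSmoothVectorField Z → T u v (Z x) w =
        ⟪curvatureField nabla (globalExtend E I u) (globalExtend E I v) Z x, w⟫_ℝ) :
    IsSCurvature (S.f x : TangentSpace I x →ₗ[ℝ] TangentSpace I x) (fun α ↦ S.xi α x) T where
  toIsLinearFStructure := S.isLinearFStructure x
  toIsAlgebraicCurvature := hT
  apply_xi u v w α := by
    have hs := hn.preservesSmooth
    have hL := S.isLinearFStructure x
    have hU : IsSmoothVectorField (globalExtend E I u) := globalExtend_smooth u
    have hV : IsSmoothVectorField (globalExtend E I v) := globalExtend_smooth v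
    rw [hTR u v w _ (S.smooth_xi α), hn.curvatureField_eq hU hV]
    simp only [along_xi hn hS hs1, along_neg (S.fField_smooth hU), along_neg (S.fField_smooth hV),
      along_fField hn hS hs1 hU, along_fField hn hS hs1 hV]
    have h1 := fun v w ↦ hL.skew (S.f x v) w
    simp only [ContinuousLinearMap.coe_coe] at h1
    simp only [Pi.add_apply, Pi.sub_apply, Pi.smul_apply', Pi.neg_apply, inner_add_left,
      inner_sub_left, inner_neg_left, real_inner_smul_left, fField_apply, globalExtend_self, h1,
      sumXi_apply, ContinuousLinearMap.coe_coe]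
    rw [real_inner_comm (S.f x v)]
    ring
  apply_f u v z w hu hv hz hw := by
    have hs := hn.preservesSmooth
    have hL := S.isLinearFStructure x
    have hU : IsSmoothVectorField (globalExtend E I u) := globalExtend_smooth u
    have hV : IsSmoothVectorField (globalExtend E I v) := globalExtend_smooth v
    have hZ : IsSmoothVectorField (globalExtend E I z) := globalExtend_smooth z
    have hP : ∀ v : TangentSpace I x, (∀ α, ⟪v, S.xi α x⟫_ℝ = 0) → ⟪v, S.sumXi x⟫_ℝ = 0 :=
      fun v hv ↦ by simp [sumXi_apply, inner_sum, hv]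
    have hPw : ⟪S.sumXi x, w⟫_ℝ = 0 := by rw [real_inner_comm, hP w hw]
    have hPz : ⟪globalExtend E I z x, S.sumXi x⟫_ℝ = 0 := by rw [globalExtend_self, hP z hz]
    have h1 := hTR u v w _ (S.fField_smooth hZ)
    have h2 := hTR u v (S.f x w) _ hZ
    rw [hn.curvatureField_eq hU hV] at h1 h2
    simp only [Pi.add_apply, Pi.sub_apply, inner_add_left, inner_sub_left] at h1 h2
    rw [inner_along_along_fField hn hS hs1 hV hZ hPz hPw,
      inner_along_along_fField hn hS hs1 hU hZ hPz hPw, along_fField hn hS hs1 hZ,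
      along_fField hn hS hs1 hZ] at h1
    simp only [Pi.add_apply, inner_add_left, Pi.smul_apply', real_inner_smul_left, hPw, hPz] at h1
    have hff := fun v hv ↦ hL.f_f_of_horizontal (X := v) hv
    have hif := fun v hv w ↦ hL.inner_f_f_of_horizontal (X := v) hv w
    have hsk := hL.skew
    simp only [ContinuousLinearMap.coe_coe] at hff hif hsk
    have e1 := hsk z u
    have e2 := hsk z v
    simp only [fField_apply, globalExtend_self, hff u hu, hff v hv, hif u hu, hif v hv,
      inner_neg_left, hsk _ w] at h1 h2
    simp only [ContinuousLinearMap.coe_coe, h1, h2, hsk u w, hsk v w]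
    rw [real_inner_comm (S.f x z) u, real_inner_comm (S.f x z) v, e1, e2]
    ring

omit hs1 hS [T2Space M] in
theorem semiSymmetric_preservesSmooth : (S.semiSymmetric nabla).PreservesSmooth :=
  fun X Y hX hY ↦ by
    rw [semiSymmetric_along]
    exact ((hn.preservesSmooth hX hY).add (hX.smul (hY.inner S.sumXi_smooth))).sub
      (S.sumXi_smooth.smul (hX.inner hY))

theorem semiSymmetric_along_along (hY : IsSmoothVectorField Y)
    (hZ : IsSmoothVectorField Z) (x : M) :
    (S.semiSymmetric nabla).along X ((S.semiSymmetric nabla).along Y Z) x =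
      nabla.along X (nabla.along Y Z) x + ⟪Z x, S.sumXi x⟫_ℝ • nabla.along X Y x
      + (⟪nabla.along X Z x, S.sumXi x⟫_ℝ - s * ⟪Z x, S.f x (X x)⟫_ℝ) • Y x
      + (⟪Y x, Z x⟫_ℝ * s) • S.f x (X x)
      + (⟪nabla.along Y Z x, S.sumXi x⟫_ℝ + ⟪Z x, S.sumXi x⟫_ℝ * ⟪Y x, S.sumXi x⟫_ℝ
        - ⟪Y x, Z x⟫_ℝ * s) • X x
      - (⟪nabla.along X Y x, Z x⟫_ℝ + ⟪Y x, nabla.along X Z x⟫_ℝ + ⟪X x, nabla.along Y Z x⟫_ℝ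
        + ⟪Z x, S.sumXi x⟫_ℝ * ⟪X x, Y x⟫_ℝ - ⟪Y x, Z x⟫_ℝ * ⟪X x, S.sumXi x⟫_ℝ) • S.sumXi x := by
  have hs := hn.preservesSmooth
  have hP := S.sumXi_smooth
  have h1 := hY.inner hZ
  have h2 := hZ.inner hP
  have hPP : ⟪S.sumXi x, S.sumXi x⟫_ℝ = s := by
    rw [sumXi_apply]
    exact (S.isLinearFStructure x).inner_sum_xi_self
  rw [semiSymmetric_along, semiSymmetric_along,
    along_sub ((hs hY hZ).add (hY.smul h2)) (hP.smul h1), along_add (hs hY hZ) (hY.smul h2),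
    along_smul h1 hP, along_smul h2 hY, along_sumXi hn hS hs1]
  simp only [Pi.add_apply, Pi.sub_apply, Pi.smul_apply', Pi.neg_apply, Pi.smul_apply,
    inner_add_left, inner_sub_left, inner_add_right, inner_sub_right, real_inner_smul_left,
    real_inner_smul_right, mvfderiv_inner_sumXi hn hS hs1 hZ, hn.mvfderiv_inner hY hZ, hPP,
    fField_apply]
  simp only [along]
  module

end MetricFStructure

end SCurvature

section SectionalCurvature

open CovariantDerivative

variable {E : Type*} [NormedAddCommGroup E] [NormedSpace ℝ E]
  {H : Type*} [TopologicalSpace H] {I : ModelWithCorners ℝ E H}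
  {M : Type*} [TopologicalSpace M] [ChartedSpace H M] [IsManifold I ∞ M]
  [RiemannianBundle (fun x : M ↦ TangentSpace I x)] {s : ℕ}

theorem sectionalCurvature_of_orthonormal
    (nabla : CovariantDerivative I E (fun x : M ↦ TangentSpace I x)) {x : M}
    {u v : TangentSpace I x} (hu : ‖u‖ = 1) (hv : ‖v‖ = 1) (huv : ⟪u, v⟫_ℝ = 0) :
    sectionalCurvature nabla x u v = ⟪curvatureAt nabla x u v v, u⟫_ℝ := by
  simp [sectionalCurvature, hu, hv, huv]

theorem sectionalCurvature_self
    (nabla : CovariantDerivative I E (fun x : M ↦ TangentSpace I x)) {x : M}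
    (u : TangentSpace I x) : sectionalCurvature nabla x u u = 0 := by
  simp [sectionalCurvature, sq]

namespace MetricFStructure

theorem mem_distL_iff (S : MetricFStructure I M s) {x : M} {u : TangentSpace I x} :
    u ∈ S.distL x ↔ ∀ α, ⟪u, S.xi α x⟫_ℝ = 0 := by
  rw [distL, Submodule.mem_orthogonal']
  refine ⟨fun h α ↦ h _ (Submodule.subset_span ⟨α, rfl⟩), fun h w hw ↦ ?_⟩
  induction hw using Submodule.span_induction with
  | mem w hw =>
    obtain ⟨α, rfl⟩ := hw
    exact h α
  | zero => exact inner_zero_right u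
  | add w w' _ _ hw hw' => rw [inner_add_right, hw, hw', add_zero]
  | smul a w _ hw => rw [real_inner_smul_right, hw, mul_zero]

variable [FiniteDimensional ℝ E] [T2Space M]
  [IsContMDiffRiemannianBundle I ∞ E (fun x : M ↦ TangentSpace I x)]
  {S : MetricFStructure I M s}
  {nabla : CovariantDerivative I E (fun x : M ↦ TangentSpace I x)} (hn : IsLeviCivita nabla)
  (hS : S.IsSStructure) (hs1 : 1 ≤ s)
include hn hS hs1

theorem inner_curvatureAt_semiSymmetric {x : M} {u v : TangentSpace I x} (hu : ‖u‖ = 1)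
    (hv : ‖v‖ = 1) (huv : ⟪u, v⟫_ℝ = 0) :
    ⟪curvatureAt (S.semiSymmetric nabla) x u v v, u⟫_ℝ =
      ⟪curvatureAt nabla x u v v, u⟫_ℝ - s + ⟪u, ∑ α, S.xi α x⟫_ℝ ^ 2
        + ⟪v, ∑ α, S.xi α x⟫_ℝ ^ 2 := by
  have hU : IsSmoothVectorField (globalExtend E I u) := globalExtend_smooth u
  have hV : IsSmoothVectorField (globalExtend E I v) := globalExtend_smooth v
  have e : curvatureField (S.semiSymmetric nabla) (globalExtend E I u) (globalExtend E I v)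
      (globalExtend E I v) x =
      (S.semiSymmetric nabla).along (globalExtend E I u)
        ((S.semiSymmetric nabla).along (globalExtend E I v) (globalExtend E I v)) x
      - (S.semiSymmetric nabla).along (globalExtend E I v)
        ((S.semiSymmetric nabla).along (globalExtend E I u) (globalExtend E I v)) x
      - (S.semiSymmetric nabla).along (mlieBracket I (globalExtend E I u) (globalExtend E I v))
        (globalExtend E I v) x := rfl
  have hvu : ⟪v, u⟫_ℝ = 0 := by rw [real_inner_comm, huv]
  have huu : ⟪u, u⟫_ℝ = 1 := by rw [real_inner_self_eq_norm_sq, hu, one_pow]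
  have hvv : ⟪v, v⟫_ℝ = 1 := by rw [real_inner_self_eq_norm_sq, hv, one_pow]
  have hfu : ⟪S.f x u, u⟫_ℝ = 0 := by
    rw [real_inner_comm]
    exact (S.isLinearFStructure x).inner_self_f u
  have hfv : ⟪v, S.f x v⟫_ℝ = 0 := (S.isLinearFStructure x).inner_self_f v
  have hfuv : ⟪S.f x v, u⟫_ℝ = -⟪v, S.f x u⟫_ℝ := (S.isLinearFStructure x).skew v u
  rw [curvatureAt_eq hn.preservesSmooth, curvatureAt_eq (semiSymmetric_preservesSmooth hn), e,
    hn.curvatureField_eq hU hV, semiSymmetric_along_along hn hS hs1 hV hV,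
    semiSymmetric_along_along hn hS hs1 hU hV, semiSymmetric_along, hn.mlieBracket_eq hU hV,
    along_sub_left]
  simp only [Pi.add_apply, Pi.sub_apply, Pi.smul_apply', inner_add_left, inner_sub_left,
    real_inner_smul_left, globalExtend_self, hvu, huu, hvv, hfu, hfv, huv, hfuv, ← sumXi_apply]
  rw [real_inner_comm u (S.sumXi x),
    real_inner_comm v (nabla.along (globalExtend E I u) (globalExtend E I v) x)]
  ring

/-- The values of the curvature tensor that enter the sectional curvatures of `nabla` and of the
semi-symmetric metric connection. -/
theorem exists_isSCurvature (x : M) :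
    ∃ T : TangentSpace I x →ₗ[ℝ] TangentSpace I x →ₗ[ℝ] TangentSpace I x →ₗ[ℝ]
        TangentSpace I x →ₗ[ℝ] ℝ,
      IsSCurvature (S.f x : TangentSpace I x →ₗ[ℝ] TangentSpace I x) (fun α ↦ S.xi α x) T ∧
      ∀ u v : TangentSpace I x, ‖u‖ = 1 → ‖v‖ = 1 → ⟪u, v⟫_ℝ = 0 →
        sectionalCurvature nabla x u v = T u v v u ∧
        sectionalCurvature (S.semiSymmetric nabla) x u v =
          T u v v u - s + ⟪u, ∑ α, S.xi α x⟫_ℝ ^ 2 + ⟪v, ∑ α, S.xi α x⟫_ℝ ^ 2 := by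
  obtain ⟨T, hT, hTR⟩ := hn.exists_curvatureForm x
  refine ⟨T, isSCurvature hn hS hs1 hT hTR, fun u v hu hv huv ↦ ?_⟩
  have h1 : T u v v u = ⟪curvatureAt nabla x u v v, u⟫_ℝ := by
    rw [curvatureAt_eq hn.preservesSmooth, ← hTR u v u _ (globalExtend_smooth v),
      globalExtend_self]
  rw [sectionalCurvature_of_orthonormal _ hu hv huv, sectionalCurvature_of_orthonormal _ hu hv huv,
    inner_curvatureAt_semiSymmetric hn hS hs1 hu hv huv, h1]
  exact ⟨rfl, rfl⟩

end MetricFStructure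

end SectionalCurvature

end

theorem mainTheorem3 {n s : ℕ} (hs : 1 ≤ s)
    {M : Type*} [TopologicalSpace M] [T2Space M] [Nonempty M]
    [ChartedSpace (EuclideanSpace ℝ (Fin (2 * n + s))) M] [IsManifold (𝓡 (2 * n + s)) ∞ M]
    [RiemannianBundle (fun x : M ↦ TangentSpace (𝓡 (2 * n + s)) x)]
    [IsContMDiffRiemannianBundle (𝓡 (2 * n + s)) ∞ (EuclideanSpace ℝ (Fin (2 * n + s)))
      (fun x : M ↦ TangentSpace (𝓡 (2 * n + s)) x)]
    (S : MetricFStructure (𝓡 (2 * n + s)) M s) (hS : S.IsSStructure)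
    (nabla : CovariantDerivative (𝓡 (2 * n + s)) (EuclideanSpace ℝ (Fin (2 * n + s)))
      (fun x : M ↦ TangentSpace (𝓡 (2 * n + s)) x))
    (hnabla : IsLeviCivita nabla) :
    (2 ≤ n → ∀ c : ℝ, S.HasConstantLSectionalCurvature (S.semiSymmetric nabla) c →
      c = 0 ∧
      ∀ (x : M)
        (e : OrthonormalBasis (Fin (2 * n + s)) ℝ (TangentSpace (𝓡 (2 * n + s)) x)),
        scalarCurvature (S.semiSymmetric nabla) x e =
          (4 * n * s + s * (s - 1)) * (2 - s) / 2) ∧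
    (∀ c : ℝ, S.HasConstantFSectionalCurvature nabla c →
      (∀ (x : M) (u v : TangentSpace (𝓡 (2 * n + s)) x), u ∈ S.distL x → v ∈ S.distL x →
        ‖u‖ = 1 → ‖v‖ = 1 → ⟪u, v⟫_ℝ = 0 →
        sectionalCurvature (S.semiSymmetric nabla) x u v =
          (c - s) / 4 * (1 + 3 * ⟪u, S.f x v⟫_ℝ ^ 2)) ∧
      ∀ (x : M)
        (e : OrthonormalBasis (Fin (2 * n + s)) ℝ (TangentSpace (𝓡 (2 * n + s)) x)),
        scalarCurvature (S.semiSymmetric nabla) x e =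
          (n * (n + 1) * (c - s) + (4 * n * s + s * (s - 1)) * (2 - s)) / 2) := by
  have hfunit : ∀ (x : M) (u : TangentSpace (𝓡 (2 * n + s)) x), u ∈ S.distL x → ‖u‖ = 1 →
      S.f x u ∈ S.distL x ∧ ‖S.f x u‖ = 1 ∧ ⟪u, S.f x u⟫_ℝ = 0 := fun x u hu hu1 ↦ by
    have hL := S.isLinearFStructure x
    refine ⟨S.mem_distL_iff.mpr (hL.inner_f_xi u), ?_, hL.inner_self_f u⟩
    have h1 : ⟪S.f x u, S.f x u⟫_ℝ = ⟪u, u⟫_ℝ :=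
      hL.inner_f_f_of_horizontal (S.mem_distL_iff.mp hu) u
    rw [real_inner_self_eq_norm_sq, real_inner_self_eq_norm_sq, hu1, one_pow] at h1
    exact (pow_eq_one_iff_of_nonneg (norm_nonneg _) two_ne_zero).mp h1
  have hsum : ∀ (x : M) (u : TangentSpace (𝓡 (2 * n + s)) x), u ∈ S.distL x →
      ⟪u, ∑ α, S.xi α x⟫_ℝ = 0 := fun x u hu ↦ by
    simp [inner_sum, S.mem_distL_iff.mp hu]
  have part2 : ∀ c : ℝ, S.HasConstantFSectionalCurvature nabla c →
      (∀ (x : M) (u v : TangentSpace (𝓡 (2 * n + s)) x), u ∈ S.distL x → v ∈ S.distL x →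
        ‖u‖ = 1 → ‖v‖ = 1 → ⟪u, v⟫_ℝ = 0 →
        sectionalCurvature (S.semiSymmetric nabla) x u v =
          (c - s) / 4 * (1 + 3 * ⟪u, S.f x v⟫_ℝ ^ 2)) ∧
      ∀ (x : M)
        (e : OrthonormalBasis (Fin (2 * n + s)) ℝ (TangentSpace (𝓡 (2 * n + s)) x)),
        scalarCurvature (S.semiSymmetric nabla) x e =
          (n * (n + 1) * (c - s) + (4 * n * s + s * (s - 1)) * (2 - s)) / 2 := by
    intro c hc
    have hT : ∀ x : M, ∃ T : TangentSpace (𝓡 (2 * n + s)) x →ₗ[ℝ] TangentSpace (𝓡 (2 * n + s)) x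
        →ₗ[ℝ] TangentSpace (𝓡 (2 * n + s)) x →ₗ[ℝ] TangentSpace (𝓡 (2 * n + s)) x →ₗ[ℝ] ℝ,
        IsSCurvature (S.f x : TangentSpace (𝓡 (2 * n + s)) x →ₗ[ℝ] TangentSpace (𝓡 (2 * n + s)) x)
          (fun α ↦ S.xi α x) T ∧
        (∀ X, (∀ α, ⟪X, S.xi α x⟫_ℝ = 0) → T X (S.f x X) (S.f x X) X = c * ⟪X, X⟫_ℝ ^ 2) ∧
        ∀ u v : TangentSpace (𝓡 (2 * n + s)) x, ‖u‖ = 1 → ‖v‖ = 1 → ⟪u, v⟫_ℝ = 0 →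
          sectionalCurvature (S.semiSymmetric nabla) x u v =
            T u v v u - s + ⟪u, ∑ α, S.xi α x⟫_ℝ ^ 2 + ⟪v, ∑ α, S.xi α x⟫_ℝ ^ 2 := fun x ↦ by
      obtain ⟨T, hT, hK⟩ := S.exists_isSCurvature hnabla hS hs x
      refine ⟨T, hT, horizontal_of_unit fun X hX hX1 ↦ ?_, fun u v hu hv huv ↦ (hK u v hu hv huv).2⟩
      have hX' := S.mem_distL_iff.mpr hX
      obtain ⟨-, h1, h2⟩ := hfunit x X hX' hX1
      rw [← hc x X hX' hX1]
      exact ((hK X _ hX1 h1 h2).1).symm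
    refine ⟨fun x u v hu hv hu1 hv1 huv ↦ ?_, fun x e ↦ ?_⟩
    · obtain ⟨T, hT, hcT, hK⟩ := hT x
      rw [hK u v hu1 hv1 huv, hsum x u hu, hsum x v hv,
        hT.apply_horizontal hcT (S.mem_distL_iff.mp hu) (S.mem_distL_iff.mp hv),
        real_inner_self_eq_norm_sq, real_inner_self_eq_norm_sq, hu1, hv1, huv]
      simp only [ContinuousLinearMap.coe_coe]
      ring
    · obtain ⟨T, hT, hcT, hK⟩ := hT x
      rw [scalarCurvature]
      exact hT.half_sum_semiSymmetric hcT e (fun i ↦ sectionalCurvature_self _ _)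
        fun i j hij ↦ hK _ _ (e.orthonormal.1 i) (e.orthonormal.1 j) (e.orthonormal.2 hij)
  refine ⟨fun hn c hc ↦ ?_, part2⟩
  have hcf : S.HasConstantFSectionalCurvature nabla (c + s) := fun x u hu hu1 ↦ by
    obtain ⟨h0, h1, h2⟩ := hfunit x u hu hu1
    obtain ⟨T, -, hK⟩ := S.exists_isSCurvature hnabla hS hs x
    have h3 := hc x u _ hu h0 hu1 h1 h2
    rw [(hK u _ hu1 h1 h2).2, hsum x u hu, hsum x _ h0] at h3
    rw [(hK u _ hu1 h1 h2).1, ← h3]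
    ring
  obtain ⟨hK, hτ⟩ := part2 _ hcf
  have hc0 : c = 0 := by
    obtain ⟨x⟩ := ‹Nonempty M›
    have : FiniteDimensional ℝ (TangentSpace (𝓡 (2 * n + s)) x) :=
      inferInstanceAs (FiniteDimensional ℝ (EuclideanSpace ℝ (Fin (2 * n + s))))
    obtain ⟨u, v, hu, hv, hu1, hv1, huv, hufv⟩ :=
      (S.isLinearFStructure x).exists_orthonormal hn
        (finrank_euclideanSpace_fin (𝕜 := ℝ) (n := 2 * n + s))
    have hu' := S.mem_distL_iff.mpr hu
    have hv' := S.mem_distL_iff.mpr hv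
    have h1 := hc x u v hu' hv' hu1 hv1 huv
    rw [hK x u v hu' hv' hu1 hv1 huv] at h1
    simp only [ContinuousLinearMap.coe_coe] at hufv
    rw [hufv] at h1
    linarith
  refine ⟨hc0, fun x e ↦ ?_⟩
  rw [hτ x e, hc0]
  ring
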